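/- Let $M\subset\mathbb{R}^n$ be open and connected. Let $f_0,f_1,\dots,f_k$ be smooth vector fields on $M$ and let $g:M\to\mathbb{R}^{n\times d}$ be smooth. Write $\mathrm{Sym}(n)$ for the space of symmetric $n\times n$ matrices, $\mathrm{Sym}^+(n)$ for the set of positive definite ones, and $Df$ for the Jacobian matrix of a vector field $f$. Consider the statistical linearization of the control-affine stochastic system $dx=\big(f_0(x)+\sum_{i=1}^k u_if_i(x)\big)\,dt+g(x)\,dW_t$, that is, the control system on $M\times\mathrm{Sym}^+(n)$ $$\dot X=F_{f_0,g}(X)+\sum_{i=1}^k u_i\,F_{f_i}(X),\qquad X=(m,P)\in M\times\mathrm{Sym}^+(n),\quad u\in\mathbb{R}^k,$$ where $$F_{f_0,g}(m,P)=\big(f_0(m),\ Df_0(m)P+P\,Df_0(m)^\top+g(m)g(m)^\top\big),\qquad F_{f_i}(m,P)=\big(f_i(m),\ Df_i(m)P+P\,Df_i(m)^\top\big).$$ For $X\in M\times\mathrm{Sym}^+(n)$ and $T\ge 0$, let $\mathcal A(X,T)$ be the set of points reached from $X$ in time exactly $T$ by trajectories of this system that stay in $M\times\mathrm{Sym}^+(n)$,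 with piecewise constant controls $u:[0,T]\to\mathbb{R}^k$, and let $\mathcal A(X)=\bigcup_{T\ge0}\mathcal A(X,T)$. Let $\mathrm{Lie}(f_1,\dots,f_k)$ be the linear span of all iterated Lie brackets $[f_{i_1},\dots,[f_{i_{r-1}},f_{i_r}]]$, $r\ge1$, $i_1,\dots,i_r\in\{1,\dots,k\}$. Suppose that for every $m\in M$ $$\dim\big\{\big(f(m),\,Df(m)+Df(m)^\top\big)\ :\ f\in\mathrm{Lie}(f_1,\dots,f_k)\big\}=n+\frac{n(n+1)}2,$$ that is, these vectors fill $\mathbb{R}^n\times\mathrm{Sym}(n)$. Then the system is controllable on $M\times\mathrm{Sym}^+(n)$ in free and fixed time: for every $X\in M\times\mathrm{Sym}^+(n)$ one has $\mathcal A(X)=M\times\mathrm{Sym}^+(n)$, and there is $T_0>0$ such that $\mathcal A(X,T)=M\times\mathrm{Sym}^+(n)$ for all $0<T<T_0$. -/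

import Mathlib

open scoped ContDiff

namespace StatLin

/-- `IteratedBracket S V`: the vector field `V` on `ℝⁿ` is an iterated Lie bracket
`[f₁, …, [f_{k-1}, f_k]]`, `k ≥ 1`, of elements `f_i` of the family `S`. -/
inductive IteratedBracket {n : ℕ} (S : Set ((Fin n → ℝ) → (Fin n → ℝ))) :
    ((Fin n → ℝ) → (Fin n → ℝ)) → Prop
  | of {V : (Fin n → ℝ) → (Fin n → ℝ)} (hV : V ∈ S) : IteratedBracket S V
  | bracket {V W : (Fin n → ℝ) → (Fin n → ℝ)} (hV : V ∈ S) (hW : IteratedBracket S W) :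
      IteratedBracket S (VectorField.lieBracket ℝ V W)

/-- The Lie algebra of vector fields generated by the family `S`: the linear span of the iterated
brackets of elements of `S`. (For fields that are smooth on an open set `M`, the values and the
derivatives on `M` of its elements depend only on the restrictions to `M` of the fields in `S`.) -/
def lieAlgebraGen {n : ℕ} (S : Set ((Fin n → ℝ) → (Fin n → ℝ))) :
    Submodule ℝ ((Fin n → ℝ) → (Fin n → ℝ)) :=
  Submodule.span ℝ {V | IteratedBracket S V}

/-- The Jacobian matrix `Df(m)`. -/
noncomputable def jacobian {n : ℕ} (f : (Fin n → ℝ) → (Fin n → ℝ)) (m : Fin n → ℝ) :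
    Matrix (Fin n) (Fin n) ℝ :=
  LinearMap.toMatrix' (fderiv ℝ f m : (Fin n → ℝ) →ₗ[ℝ] (Fin n → ℝ))

/-- The subspace of `ℝⁿ × Sym(n)` spanned by the vectors `(f(m), Df(m) + Df(m)ᵀ)`, where `f` runs
through the Lie algebra generated by the family `S`. -/
noncomputable def lieOneJet {n : ℕ} (S : Set ((Fin n → ℝ) → (Fin n → ℝ))) (m : Fin n → ℝ) :
    Submodule ℝ ((Fin n → ℝ) × Matrix (Fin n) (Fin n) ℝ) :=
  Submodule.span ℝ
    {v | ∃ f ∈ lieAlgebraGen S, v = (f m, jacobian f m + (jacobian f m).transpose)}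

/-- The state space `M × Sym⁺(n)`, where `Sym⁺(n)` is the set of symmetric positive definite
matrices. -/
def stateSpace {n : ℕ} (M : Set (Fin n → ℝ)) : Set ((Fin n → ℝ) × Matrix (Fin n) (Fin n) ℝ) :=
  {X | X.1 ∈ M ∧ X.2.PosDef}

/-- `F_f(m, P) = (f(m), Df(m) P + P Df(m)ᵀ)`. -/
noncomputable def controlField {n : ℕ} (f : (Fin n → ℝ) → (Fin n → ℝ))
    (X : (Fin n → ℝ) × Matrix (Fin n) (Fin n) ℝ) : (Fin n → ℝ) × Matrix (Fin n) (Fin n) ℝ :=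
  (f X.1, jacobian f X.1 * X.2 + X.2 * (jacobian f X.1).transpose)

/-- `F_{f,g}(m, P) = (f(m), Df(m) P + P Df(m)ᵀ + g(m) g(m)ᵀ)`. -/
noncomputable def driftField {n d : ℕ} (f : (Fin n → ℝ) → (Fin n → ℝ))
    (g : (Fin n → ℝ) → Matrix (Fin n) (Fin d) ℝ)
    (X : (Fin n → ℝ) × Matrix (Fin n) (Fin n) ℝ) : (Fin n → ℝ) × Matrix (Fin n) (Fin n) ℝ :=
  (f X.1, jacobian f X.1 * X.2 + X.2 * (jacobian f X.1).transpose + g X.1 * (g X.1).transpose)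

/-- The right-hand side `F_{f₀,g}(X) + ∑ᵢ uᵢ F_{fᵢ}(X)` of the statistical linearization of the
stochastic control system `dx = (f₀(x) + ∑ᵢ uᵢ fᵢ(x)) dt + g(x) dW`. -/
noncomputable def statLinearization {n d k : ℕ} (f₀ : (Fin n → ℝ) → (Fin n → ℝ))
    (f : Fin k → (Fin n → ℝ) → (Fin n → ℝ)) (g : (Fin n → ℝ) → Matrix (Fin n) (Fin d) ℝ)
    (X : (Fin n → ℝ) × Matrix (Fin n) (Fin n) ℝ) (u : Fin k → ℝ) :
    (Fin n → ℝ) × Matrix (Fin n) (Fin n) ℝ :=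
  driftField f₀ g X + ∑ i, u i • controlField (f i) X

/-- `X` is a trajectory on `[0, T]`, inside `Ω`, of the control system `Ẋ = F(X, u)` for the
piecewise constant control `u`: it is continuous on `[0, T]`, and away from a finite set of times
`u` is locally constant and the differential equation holds. -/
structure IsTrajectory {n k : ℕ} (Ω : Set ((Fin n → ℝ) × Matrix (Fin n) (Fin n) ℝ))
    (F : (Fin n → ℝ) × Matrix (Fin n) (Fin n) ℝ → (Fin k → ℝ) →
      (Fin n → ℝ) × Matrix (Fin n) (Fin n) ℝ)
    (T : ℝ) (u : ℝ → Fin k → ℝ) (X : ℝ → (Fin n → ℝ) × Matrix (Fin n) (Fin n) ℝ) : Prop where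
  continuousOn : ContinuousOn X (Set.Icc 0 T)
  mem : ∀ t ∈ Set.Icc 0 T, X t ∈ Ω
  piecewise : ∃ s : Finset ℝ, ∀ t ∈ Set.Ioo 0 T, t ∉ s →
    (∀ᶠ r in nhds t, u r = u t) ∧ HasDerivAt X (F (X t) (u t)) t

/-- The reachable set `A(x, T)` from `x` in time exactly `T`. -/
def reachableSet {n k : ℕ} (Ω : Set ((Fin n → ℝ) × Matrix (Fin n) (Fin n) ℝ))
    (F : (Fin n → ℝ) × Matrix (Fin n) (Fin n) ℝ → (Fin k → ℝ) →
      (Fin n → ℝ) × Matrix (Fin n) (Fin n) ℝ)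
    (x : (Fin n → ℝ) × Matrix (Fin n) (Fin n) ℝ) (T : ℝ) :
    Set ((Fin n → ℝ) × Matrix (Fin n) (Fin n) ℝ) :=
  {y | ∃ (u : ℝ → Fin k → ℝ) (X : ℝ → (Fin n → ℝ) × Matrix (Fin n) (Fin n) ℝ),
    IsTrajectory Ω F T u X ∧ X 0 = x ∧ X T = y}

/-- Controllability on `Ω` in free and fixed time: for every `x ∈ Ω`, `⋃_{T ≥ 0} A(x, T) = Ω`, and
`A(x, T) = Ω` for all sufficiently small `T > 0`. -/
def ControllableFreeAndFixedTime {n k : ℕ}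
    (Ω : Set ((Fin n → ℝ) × Matrix (Fin n) (Fin n) ℝ))
    (F : (Fin n → ℝ) × Matrix (Fin n) (Fin n) ℝ → (Fin k → ℝ) →
      (Fin n → ℝ) × Matrix (Fin n) (Fin n) ℝ) : Prop :=
  ∀ x ∈ Ω, (⋃ T ∈ Set.Ici (0 : ℝ), reachableSet Ω F x T) = Ω ∧
    ∃ T₀ : ℝ, 0 < T₀ ∧ ∀ T : ℝ, 0 < T → T < T₀ → reachableSet Ω F x T = Ω

end StatLin

/-!
Along `(m, A) ↦ (m, A Aᵀ)` the system lifts to the bundle of linear frames `M × GL(n)`, where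
`F_f` becomes `(f, Df · A)`; the rotations `(0, A (B - Bᵀ))` are tangent to the fibres and can be
added as control fields for free. As `A + Aᵀ` determines `A` up to a skew matrix, the rank condition
says that the lifted control fields and the rotations bracket-generate at `(m, 1)`.

The lifted control fields and their arcs are invariant under right multiplication of the frame by a
constant matrix. Hence the open orbits of the driftless lifted system through the frames `(m, 1)`
propagate: along `M` because it is connected, and along the positive definite frames over a fixed
point, which suffice since every `P > 0` is `C Cᵀ` with `C > 0`. The orbit of `(m, 1)` therefore
meets every fibre of the projection.

For the orbits themselves, consider steerings that can be varied with parameters, and the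
displacements of the end point that the parameters allow. Conjugating a loop at a nearby point by an
arc shows that these directions are invariant under the control flows; differentiating this
invariance in time, they are stable under brackets with the control fields. Where they fill the
space the end point map is a submersion, and, as its derivative depends continuously on a drift
`ε F₀` put on each of its `ℓ` arcs, a target reached without drift is still reached for all small
`ε`, that is, after rescaling time, in time exactly `ℓ ε`.
-/

namespace AffineControl

open Filter Topology Set unitInterval

universe u

section Superposition

section Continuous

variable {K V W : Type*} [TopologicalSpace K] [TopologicalSpace V] [TopologicalSpace W]

open Classical in
/-- The superposition (Nemytskii) operator `γ ↦ F ∘ γ` on spaces of continuous maps, through which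
a differential equation becomes an equation in a Banach space. It takes the value zero where
`F ∘ γ` is not continuous. -/
noncomputable def superposition [Zero W] (F : V → W) (γ : C(K, V)) : C(K, W) :=
  if h : Continuous (F ∘ γ) then ⟨F ∘ γ, h⟩ else 0

lemma superposition_apply [Zero W] {F : V → W} {U : Set V} (hF : ContinuousOn F U) {γ : C(K, V)}
    (hγ : ∀ t, γ t ∈ U) (t : K) : superposition F γ t = F (γ t) := by
  have h : Continuous (F ∘ γ) := hF.comp_continuous γ.continuous hγ
  simp [superposition, h]

lemma isOpen_setOf_forall_mem [CompactSpace K] {U : Set V} (hU : IsOpen U) :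
    IsOpen {γ : C(K, V) | ∀ t, γ t ∈ U} := by
  simpa [MapsTo] using ContinuousMap.isOpen_setOfPred_mapsTo (X := K) isCompact_univ hU

lemma continuousOn_superposition [LocallyCompactSpace K] [Zero W] {F : V → W} {U : Set V}
    (hF : ContinuousOn F U) : ContinuousOn (superposition (K := K) F) {γ | ∀ t, γ t ∈ U} := by
  refine ContinuousMap.continuousOn_of_continuousOn_uncurry _ ?_
  have h : ContinuousOn (fun p : C(K, V) × K => F (p.1 p.2)) ({γ | ∀ t, γ t ∈ U} ×ˢ univ) :=
    hF.comp (by fun_prop) fun p hp => hp.1 p.2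
  exact h.congr fun p hp => superposition_apply hF hp.1 p.2

end Continuous

variable {K : Type*} [TopologicalSpace K] [CompactSpace K]
variable {V : Type*} [NormedAddCommGroup V] [NormedSpace ℝ V]
variable {W : Type*} [NormedAddCommGroup W] [NormedSpace ℝ W]

/-- Pointwise application of a continuous family of linear maps to a continuous map, as a bounded
bilinear map. The derivative of a superposition operator is of this form. -/
noncomputable def pointwiseApply :
    C(K, V →L[ℝ] W) →L[ℝ] C(K, V) →L[ℝ] C(K, W) :=
  LinearMap.mkContinuous₂
    (LinearMap.mk₂ ℝ (fun (A : C(K, V →L[ℝ] W)) (η : C(K, V)) =>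
        (⟨fun t => A t (η t), A.continuous.clm_apply η.continuous⟩ : C(K, W)))
      (fun A B η => by ext t; simp) (fun c A η => by ext t; simp)
      (fun A η ξ => by ext t; simp) (fun c A η => by ext t; simp)) 1
    (fun A η => by
      rw [one_mul, ContinuousMap.norm_le _ (by positivity)]
      intro t
      exact (ContinuousLinearMap.le_opNorm _ _).trans
        (by gcongr; exacts [A.norm_coe_le_norm t, η.norm_coe_le_norm t]))

@[simp] lemma pointwiseApply_apply (A : C(K, V →L[ℝ] W)) (η : C(K, V)) (t : K) :
    pointwiseApply A η t = A t (η t) := rfl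

lemma eventually_forall_norm_sub_sub_fderiv_le {F : V → W} {U C : Set V} (hU : IsOpen U)
    (hF : ContDiffOn ℝ 1 F U) (hC : IsCompact C) (hCU : C ⊆ U) {c : ℝ} (hc : 0 < c) :
    ∀ᶠ h in 𝓝 (0 : V), ∀ x ∈ C, ‖F (x + h) - F x - fderiv ℝ F x h‖ ≤ c * ‖h‖ := by
  refine hC.eventually_forall_of_forall_eventually fun x₀ hx₀ => ?_
  have hU₀ : U ∈ 𝓝 x₀ := hU.mem_nhds (hCU hx₀)
  have hstrict := ((hF.contDiffAt hU₀).hasStrictFDerivAt one_ne_zero).isLittleO.def (half_pos hc)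
  have hcont : ∀ᶠ x in 𝓝 x₀, dist (fderiv ℝ F x) (fderiv ℝ F x₀) < c / 2 :=
    Metric.tendsto_nhds.1
      ((hF.continuousOn_fderiv_of_isOpen hU le_rfl).continuousAt hU₀) _ (half_pos hc)
  have hpair : Tendsto (fun p : V × V => (p.2 + p.1, p.2)) (𝓝 (0, x₀)) (𝓝 (x₀, x₀)) :=
    Continuous.tendsto' (by fun_prop) _ _ (by simp)
  have hsnd : Tendsto (fun p : V × V => p.2) (𝓝 (0, x₀)) (𝓝 x₀) := continuous_snd.tendsto' _ _ rfl
  filter_upwards [hpair.eventually hstrict, hsnd.eventually hcont] with ⟨h, x⟩ hh hx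
  rw [add_sub_cancel_left] at hh
  rw [dist_eq_norm] at hx
  calc ‖F (x + h) - F x - fderiv ℝ F x h‖
      = ‖(F (x + h) - F x - fderiv ℝ F x₀ h) - (fderiv ℝ F x - fderiv ℝ F x₀) h‖ := by simp
    _ ≤ c / 2 * ‖h‖ + c / 2 * ‖h‖ :=
      (norm_sub_le _ _).trans
        (add_le_add hh ((ContinuousLinearMap.le_opNorm _ _).trans (by gcongr)))
    _ = c * ‖h‖ := by ring

lemma hasFDerivAt_superposition {F : V → W} {U : Set V} (hU : IsOpen U)
    (hF : ContDiffOn ℝ 1 F U) {γ : C(K, V)} (hγ : ∀ t, γ t ∈ U) :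
    HasFDerivAt (superposition (K := K) F) (pointwiseApply (superposition (fderiv ℝ F) γ)) γ := by
  have hdF := hF.continuousOn_fderiv_of_isOpen hU le_rfl
  refine HasFDerivAt.of_isLittleO (Asymptotics.isLittleO_iff.2 fun c hc => ?_)
  obtain ⟨δ, hδ, hF_le⟩ := Metric.eventually_nhds_iff.1
    (eventually_forall_norm_sub_sub_fderiv_le hU hF (isCompact_range γ.continuous)
      (range_subset_iff.2 hγ) hc)
  filter_upwards [(isOpen_setOf_forall_mem hU).mem_nhds hγ, Metric.ball_mem_nhds γ hδ]
    with γ' hγ' hdist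
  rw [ContinuousMap.norm_le _ (by positivity)]
  intro t
  have hle : ‖γ' t - γ t‖ ≤ ‖γ' - γ‖ := (γ' - γ).norm_coe_le_norm t
  have hlt : dist (γ' t - γ t) 0 < δ := by
    rw [dist_zero_right]
    exact hle.trans_lt (by simpa [dist_eq_norm] using hdist)
  have hbound := hF_le hlt (γ t) (mem_range_self t)
  rw [add_sub_cancel] at hbound
  simp only [ContinuousMap.sub_apply, pointwiseApply_apply, superposition_apply hF.continuousOn hγ,
    superposition_apply hF.continuousOn hγ', superposition_apply hdF hγ]
  exact hbound.trans (by gcongr)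

theorem contDiffOn_superposition [LocallyCompactSpace K] {V : Type u} [NormedAddCommGroup V]
    [NormedSpace ℝ V] {U : Set V} (hU : IsOpen U) (n : ℕ) {W : Type u} [NormedAddCommGroup W]
    [NormedSpace ℝ W] {F : V → W} (hF : ContDiffOn ℝ n F U) :
    ContDiffOn ℝ n (superposition (K := K) F) {γ : C(K, V) | ∀ t, γ t ∈ U} := by
  induction n generalizing W with
  | zero =>
    rw [Nat.cast_zero, contDiffOn_zero] at hF ⊢
    exact continuousOn_superposition hF
  | succ n ih =>
    have hderiv : ∀ γ ∈ {γ : C(K, V) | ∀ t, γ t ∈ U}, HasFDerivAt (superposition (K := K) F)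
        (pointwiseApply (superposition (fderiv ℝ F) γ)) γ :=
      fun γ hγ => hasFDerivAt_superposition hU (hF.of_le (by simp)) hγ
    rw [Nat.cast_add, Nat.cast_one,
      contDiffOn_succ_iff_fderiv_of_isOpen (isOpen_setOf_forall_mem hU)]
    refine ⟨fun γ hγ => (hderiv γ hγ).differentiableAt.differentiableWithinAt, by simp, ?_⟩
    have hfderiv : ContDiffOn ℝ n (fderiv ℝ F) U := hF.fderiv_of_isOpen hU (by simp)
    have happly : ContDiff ℝ n (pointwiseApply (K := K) (V := V) (W := W)) :=
      ContinuousLinearMap.contDiff _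
    exact (happly.comp_contDiffOn (ih hfderiv)).congr fun γ hγ => (hderiv γ hγ).fderiv

end Superposition

section Arc

variable {V : Type*} [NormedAddCommGroup V] [NormedSpace ℝ V] {U : Set V} {Z : V → V} {x y y' : V}

/-- There is an integral curve of `Z` in `U`, defined on `[0, 1]`, from `x` to `y`. Flowing for
another time `t` amounts to replacing `Z` by `t • Z`. -/
def Arc (U : Set V) (Z : V → V) (x y : V) : Prop :=
  ∃ γ : ℝ → V, γ 0 = x ∧ γ 1 = y ∧ MapsTo γ (Icc 0 1) U ∧
    IsIntegralCurveOn γ (fun _ => Z) (Icc 0 1)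

lemma arc_of_isIntegralCurveOn {γ : ℝ → V} (hU : MapsTo γ (Icc 0 1) U)
    (hγ : IsIntegralCurveOn γ (fun _ => Z) (Icc 0 1)) {s t : ℝ} (hs : s ∈ Icc (0 : ℝ) 1)
    (ht : t ∈ Icc (0 : ℝ) 1) : Arc U ((t - s) • Z) (γ s) (γ t) := by
  have hmaps : ∀ τ ∈ Icc (0 : ℝ) 1, τ * (t - s) + s ∈ Icc (0 : ℝ) 1 := fun τ hτ => by
    have := (convex_Icc (0 : ℝ) 1).add_smul_sub_mem hs ht hτ
    rwa [smul_eq_mul, add_comm] at this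
  refine ⟨fun τ => γ (τ * (t - s) + s), by simp, by simp, fun τ hτ => hU (hmaps τ hτ), ?_⟩
  refine ((hγ.comp_add s).comp_mul (t - s)).mono fun τ hτ => ?_
  rw [mem_ofPred_eq, mem_vadd_set_iff_neg_vadd_mem, neg_neg, vadd_eq_add, add_comm]
  exact hmaps τ hτ

lemma Arc.left_mem (h : Arc U Z x y) : x ∈ U := by
  obtain ⟨γ, rfl, -, hU, -⟩ := h
  exact hU (by simp)

lemma Arc.right_mem (h : Arc U Z x y) : y ∈ U := by
  obtain ⟨γ, -, rfl, hU, -⟩ := h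
  exact hU (by simp)

lemma Arc.symm (h : Arc U Z x y) : Arc U (-Z) y x := by
  obtain ⟨γ, rfl, rfl, hU, hγ⟩ := h
  simpa using arc_of_isIntegralCurveOn hU hγ (s := 1) (t := 0) (by simp) (by simp)

lemma arc_zero (hx : x ∈ U) : Arc U (0 : V → V) x x :=
  ⟨fun _ => x, rfl, rfl, fun _ _ => hx, (isIntegralCurve_const fun _ => rfl).isIntegralCurveOn _⟩

lemma exists_lipschitzOnWith_of_contDiffOn {W : Type*} [NormedAddCommGroup W] [NormedSpace ℝ W]
    {F : V → W} (hU : IsOpen U) (hF : ContDiffOn ℝ 1 F U) {C : Set V} (hC : IsCompact C)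
    (hCU : C ⊆ U) : ∃ L, LipschitzOnWith L F C := by
  refine LocallyLipschitzOn.exists_lipschitzOnWith_of_compact hC fun z hz => ?_
  obtain ⟨L, t, ht, hL⟩ := (hF.contDiffAt (hU.mem_nhds (hCU hz))).exists_lipschitzOnWith
  exact ⟨L, t, mem_nhdsWithin_of_mem_nhds ht, hL⟩

lemma Arc.unique (hU : IsOpen U) (hZ : ContDiffOn ℝ 1 Z U) (h : Arc U Z x y) (h' : Arc U Z x y') :
    y = y' := by
  obtain ⟨γ, h0, rfl, hγU, hγ⟩ := h
  obtain ⟨γ', h0', rfl, hγU', hγ'⟩ := h'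
  obtain ⟨L, hL⟩ := exists_lipschitzOnWith_of_contDiffOn hU hZ
    ((isCompact_Icc.image_of_continuousOn hγ.continuousOn).union
      (isCompact_Icc.image_of_continuousOn hγ'.continuousOn))
    (union_subset hγU.image_subset hγU'.image_subset)
  have hright : ∀ {η : ℝ → V}, IsIntegralCurveOn η (fun _ => Z) (Icc 0 1) →
      ∀ t ∈ Ico (0 : ℝ) 1, HasDerivWithinAt η (Z (η t)) (Ici t) t := fun hη t ht =>
    ((hη t (Ico_subset_Icc_self ht)).mono (Icc_subset_Icc_left ht.1)).mono_of_mem_nhdsWithin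
      (Icc_mem_nhdsGE ht.2)
  exact ODE_solution_unique_of_mem_Icc_right (v := fun _ => Z) (fun _ _ => hL)
    hγ.continuousOn (hright hγ) (fun t ht => .inl (mem_image_of_mem γ (Ico_subset_Icc_self ht)))
    hγ'.continuousOn (hright hγ') (fun t ht => .inr (mem_image_of_mem γ' (Ico_subset_Icc_self ht)))
    (h0.trans h0'.symm) (by simp)

lemma Arc.map {W : Type*} [NormedAddCommGroup W] [NormedSpace ℝ W] {T : V → W} {U' : Set W}
    {Z' : W → W} (h : Arc U Z x y) (hT : ∀ p ∈ U, DifferentiableAt ℝ T p) (hmaps : MapsTo T U U')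
    (hZ : ∀ p ∈ U, fderiv ℝ T p (Z p) = Z' (T p)) : Arc U' Z' (T x) (T y) := by
  obtain ⟨γ, rfl, rfl, hγU, hγ⟩ := h
  refine ⟨T ∘ γ, rfl, rfl, hmaps.comp hγU, fun t ht => ?_⟩
  have := (hT _ (hγU ht)).hasFDerivAt.comp_hasDerivWithinAt t (hγ t ht)
  rwa [hZ _ (hγU ht)] at this

lemma Arc.eq_of_fderiv_apply_eq_zero {W : Type*} [NormedAddCommGroup W] [NormedSpace ℝ W]
    {T : V → W} (h : Arc U Z x y) (hT : ∀ p ∈ U, DifferentiableAt ℝ T p)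
    (hZ : ∀ p ∈ U, fderiv ℝ T p (Z p) = 0) : T x = T y :=
  Arc.unique (Z := 0) isOpen_univ contDiffOn_const (arc_zero (mem_univ _))
    (h.map hT (mapsTo_univ _ _) hZ)

end Arc

section ParametricFlow

/-- The Volterra operator `η ↦ ∫₀ᵗ η` on continuous curves. -/
noncomputable def volterra {V : Type*} [NormedAddCommGroup V] [NormedSpace ℝ V] [CompleteSpace V] :
    C(I, V) →L[ℝ] C(I, V) :=
  LinearMap.mkContinuous
    { toFun := fun η => ⟨fun t => ∫ s in (0 : ℝ)..t, IccExtend zero_le_one η s, by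
        have h : Continuous (IccExtend (zero_le_one (α := ℝ)) η) := η.continuous.Icc_extend'
        exact (intervalIntegral.continuous_primitive
          (fun a b => h.intervalIntegrable a b) 0).comp continuous_subtype_val⟩
      map_add' := fun η ξ => by
        ext t
        have h : Continuous (IccExtend (zero_le_one (α := ℝ)) η) := η.continuous.Icc_extend'
        have h' : Continuous (IccExtend (zero_le_one (α := ℝ)) ξ) := ξ.continuous.Icc_extend'
        exact intervalIntegral.integral_add (h.intervalIntegrable 0 t) (h'.intervalIntegrable 0 t)
      map_smul' := fun c η => by
        ext t
        exact intervalIntegral.integral_smul c _ } 1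
    (fun η => by
      rw [one_mul, ContinuousMap.norm_le _ (by positivity)]
      intro t
      refine (intervalIntegral.norm_integral_le_of_norm_le_const
        (C := ‖η‖) fun s _ => η.norm_coe_le_norm _).trans ?_
      rw [sub_zero, abs_of_nonneg t.2.1]
      exact mul_le_of_le_one_right (norm_nonneg _) t.2.2)

lemma arc_of_eq_add_volterra {V : Type*} [NormedAddCommGroup V] [NormedSpace ℝ V] [CompleteSpace V]
    {U : Set V} {Z : V → V} {x : V} {γ η : C(I, V)} (hU : ∀ t, γ t ∈ U)
    (hη : ∀ t, η t = Z (γ t)) (hγ : ∀ t, γ t = x + volterra η t) : Arc U Z x (γ 1) := by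
  have hc : Continuous (IccExtend (zero_le_one (α := ℝ)) η) := η.continuous.Icc_extend'
  have hγ_apply (t : ℝ) (ht : t ∈ I) :
      x + ∫ s in (0 : ℝ)..t, IccExtend zero_le_one η s = γ ⟨t, ht⟩ := (hγ ⟨t, ht⟩).symm
  refine ⟨fun t => x + ∫ s in (0 : ℝ)..t, IccExtend zero_le_one η s, by simp, (hγ 1).symm,
    fun t ht => ?_, fun t ht => ?_⟩ <;> beta_reduce <;> rw [hγ_apply t ht]
  · exact hU _
  · have hderiv := ((hc.integral_hasStrictDerivAt 0 t).hasDerivAt.const_add x).hasDerivWithinAt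
      (s := Icc 0 1)
    rwa [IccExtend_of_mem _ _ ht, hη] at hderiv

variable {V : Type u} [NormedAddCommGroup V] [NormedSpace ℝ V]
  {Λ : Type} [NormedAddCommGroup Λ] [NormedSpace ℝ Λ]

/-- The curve `t ↦ (γ t, λ)`, as a linear function of the curve `γ` and the parameter `λ`. -/
noncomputable def withParam : C(I, V) × Λ →L[ℝ] C(I, V × Λ) :=
  ((ContinuousLinearMap.inl ℝ V Λ).compLeftContinuous ℝ I).coprod
    (((ContinuousLinearMap.inr ℝ V Λ).compLeftContinuous ℝ I).comp
      (ContinuousLinearMap.const ℝ I))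

@[simp] lemma withParam_apply (γ : C(I, V)) (l : Λ) (t : I) : withParam (γ, l) t = (γ t, l) := by
  simp [withParam]

variable [CompleteSpace V] {F : V × Λ → V} {U : Set V}

/-- The defect `γ - x - ∫₀ᵗ F(γ, λ)` of a curve `γ` in the integral equation of the initial value
problem `γ' = F(γ, λ)`, `γ(0) = x`. The argument is `((x, λ), γ)`. -/
noncomputable def integralDefect (F : V × Λ → V) (p : (V × Λ) × C(I, V)) : C(I, V) :=
  p.2 - ContinuousMap.const I p.1.1 - volterra (superposition F (withParam (p.2, p.1.2)))

lemma contDiffAt_integralDefect (hU : IsOpen U) {r : ℕ} (hF : ContDiffOn ℝ r F (U ×ˢ univ))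
    {p : (V × Λ) × C(I, V)} (hp : ∀ t, p.2 t ∈ U) : ContDiffAt ℝ r (integralDefect F) p := by
  have hsup : ContDiffAt ℝ r (superposition (K := I) F) (withParam (p.2, p.1.2)) :=
    (contDiffOn_superposition (hU.prod isOpen_univ) r hF).contDiffAt
      ((isOpen_setOf_forall_mem (hU.prod isOpen_univ)).mem_nhds fun t => by simpa using hp t)
  have hcurve : ContDiffAt ℝ r
      (fun q : (V × Λ) × C(I, V) => withParam (q.2, q.1.2)) p := by fun_prop
  have hconst : ContDiff ℝ r (fun x : V => ContinuousMap.const I x) :=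
    (ContinuousLinearMap.const ℝ I : V →L[ℝ] C(I, V)).contDiff
  have hvolterra : ContDiff ℝ r (volterra (V := V)) := ContinuousLinearMap.contDiff _
  have hintegrand : ContDiffAt ℝ r
      (fun q : (V × Λ) × C(I, V) => superposition F (withParam (q.2, q.1.2))) p :=
    ContDiffAt.comp (f := fun q : (V × Λ) × C(I, V) => withParam (q.2, q.1.2)) p hsup hcurve
  exact (contDiffAt_snd.sub (hconst.contDiffAt.comp p (by fun_prop))).sub
    (hvolterra.contDiffAt.comp p hintegrand)

lemma arc_of_integralDefect_eq_zero (hF : ContinuousOn F (U ×ˢ univ)) {q : V × Λ} {γ : C(I, V)}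
    (hγ : ∀ t, γ t ∈ U) (h : integralDefect F (q, γ) = 0) :
    Arc U (fun x => F (x, q.2)) q.1 (γ 1) := by
  refine arc_of_eq_add_volterra (η := superposition F (withParam (γ, q.2))) hγ (fun t => ?_)
    fun t => ?_
  · rw [superposition_apply hF fun s => by simpa using hγ s, withParam_apply]
  · rw [integralDefect, sub_sub, sub_eq_zero] at h
    exact congr($h t)

lemma integralDefect_of_eq_zero (hF : ContinuousOn F (U ×ˢ univ)) {l : Λ}
    (hl : ∀ x ∈ U, F (x, l) = 0) (x : V) {γ : C(I, V)} (hγ : ∀ t, γ t ∈ U) :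
    integralDefect F ((x, l), γ) = γ - ContinuousMap.const I x := by
  have hsup : superposition F (withParam (γ, l)) = 0 := by
    ext t
    rw [superposition_apply hF fun s => by simpa using hγ s, withParam_apply, hl _ (hγ t)]
    rfl
  simp [integralDefect, hsup]

variable [CompleteSpace Λ]

theorem exists_contDiffAt_arc (hU : IsOpen U) {r : ℕ} (hr : r ≠ 0)
    (hF : ContDiffOn ℝ r F (U ×ˢ univ)) {l : Λ} (hl : ∀ x ∈ U, F (x, l) = 0) {x₀ : V}
    (hx₀ : x₀ ∈ U) : ∃ G : V × Λ → V, ContDiffAt ℝ r G (x₀, l) ∧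
      ∀ᶠ q in 𝓝 (x₀, l), Arc U (fun x => F (x, q.2)) q.1 (G q) := by
  let p : (V × Λ) × C(I, V) := ((x₀, l), ContinuousMap.const I x₀)
  have hr' : (r : ℕ∞ω) ≠ 0 := by exact_mod_cast hr
  have hmem : {γ : C(I, V) | ∀ t, γ t ∈ U} ∈ 𝓝 p.2 :=
    (isOpen_setOf_forall_mem hU).mem_nhds fun _ => hx₀
  have hsmooth : ContDiffAt ℝ r (integralDefect F) p :=
    contDiffAt_integralDefect hU hF fun _ => hx₀
  have hpartial : fderiv ℝ (integralDefect F) p ∘L .inr ℝ (V × Λ) C(I, V) = .id ℝ _ := by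
    refine ((hsmooth.differentiableAt hr').hasFDerivAt.comp p.2
      (hasFDerivAt_prodMk_right p.1 p.2)).unique ?_
    refine ((hasFDerivAt_id p.2).sub_const (ContinuousMap.const I x₀)).congr_of_eventuallyEq ?_
    filter_upwards [hmem] with γ hγ using integralDefect_of_eq_zero hF.continuousOn hl x₀ hγ
  have hinv : (fderiv ℝ (integralDefect F) p ∘L .inr ℝ (V × Λ) C(I, V)).IsInvertible :=
    ⟨.refl ℝ _, hpartial.symm⟩
  have hzero : integralDefect F p = 0 := by
    rw [integralDefect_of_eq_zero hF.continuousOn hl x₀ fun _ => hx₀, sub_self]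
  let ψ := hsmooth.implicitFunction hr' hinv
  have hψ : ContDiffAt ℝ r ψ (x₀, l) := hsmooth.contDiffAt_implicitFunction hr' hinv
  refine ⟨fun q => ψ q 1,
    (ContinuousMap.evalCLM ℝ 1 : C(I, V) →L[ℝ] V).contDiff.contDiffAt.comp (x₀, l) hψ, ?_⟩
  have hψ_mem : ∀ᶠ q in 𝓝 (x₀, l), ∀ t, ψ q t ∈ U :=
    hψ.continuousAt.eventually (by rwa [show ψ (x₀, l) = p.2 from
      hsmooth.implicitFunction_apply_self hr' hinv])
  filter_upwards [hψ_mem, hsmooth.eventually_apply_implicitFunction hr' hinv] with q hq hq'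
  exact arc_of_integralDefect_eq_zero hF.continuousOn hq (hq'.trans hzero)

end ParametricFlow

section LocalFlow

variable {V : Type*} [NormedAddCommGroup V] [NormedSpace ℝ V] {U : Set V} {Z : V → V} {x₀ : V}
  {φ : V × ℝ → V}

/-- `φ (x, t)` is the point reached at time `t` by the integral curve of `Z` in `U` that starts at
`x`, for `x` near `x₀` and `t` near `0`. Two derivatives of `φ` are what the computation of a Lie
bracket from the flow uses. -/
structure IsLocalFlow (U : Set V) (Z : V → V) (x₀ : V) (φ : V × ℝ → V) : Prop where
  contDiffAt : ContDiffAt ℝ 2 φ (x₀, 0)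
  eventually_arc : ∀ᶠ p in 𝓝 (x₀, (0 : ℝ)), Arc U (p.2 • Z) p.1 (φ p)

namespace IsLocalFlow

lemma mem (hφ : IsLocalFlow U Z x₀ φ) : x₀ ∈ U := hφ.eventually_arc.self_of_nhds.left_mem

lemma eventually_isLocalFlow (hφ : IsLocalFlow U Z x₀ φ) : ∀ᶠ x in 𝓝 x₀, IsLocalFlow U Z x φ := by
  have h : Tendsto (fun x : V => (x, (0 : ℝ))) (𝓝 x₀) (𝓝 (x₀, 0)) :=
    (Continuous.prodMk_left (0 : ℝ)).tendsto _
  filter_upwards [h.eventually (hφ.contDiffAt.eventually (by simp)),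
    h.eventually hφ.eventually_arc.eventually_nhds] with x hx hx' using ⟨hx, hx'⟩

lemma eventually_differentiableAt (hφ : IsLocalFlow U Z x₀ φ) :
    ∀ᶠ p in 𝓝 (x₀, (0 : ℝ)), DifferentiableAt ℝ φ p := by
  filter_upwards [hφ.contDiffAt.eventually (by simp)] with p hp
    using hp.differentiableAt two_ne_zero

lemma hasFDerivAt (hφ : IsLocalFlow U Z x₀ φ) : HasFDerivAt φ (fderiv ℝ φ (x₀, 0)) (x₀, 0) :=
  hφ.eventually_differentiableAt.self_of_nhds.hasFDerivAt

lemma hasFDerivAt_fderiv (hφ : IsLocalFlow U Z x₀ φ) :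
    HasFDerivAt (fderiv ℝ φ) (fderiv ℝ (fderiv ℝ φ) (x₀, 0)) (x₀, 0) :=
  ((hφ.contDiffAt.fderiv_right (m := 1) (by norm_num)).differentiableAt one_ne_zero).hasFDerivAt

section Unique

variable (hU : IsOpen U) (hZ : ContDiffOn ℝ 1 Z U)
include hU hZ

lemma apply_zero (hφ : IsLocalFlow U Z x₀ φ) : φ (x₀, 0) = x₀ := by
  have hzero : Arc U ((0 : ℝ) • Z) x₀ x₀ := by simpa using arc_zero hφ.mem
  exact hφ.eventually_arc.self_of_nhds.unique hU (hZ.const_smul 0) hzero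

lemma tendsto_neg (hφ : IsLocalFlow U Z x₀ φ) :
    Tendsto (fun p : V × ℝ => (φ p, -p.2)) (𝓝 (x₀, 0)) (𝓝 (x₀, 0)) := by
  have h : ContinuousAt (fun p : V × ℝ => (φ p, -p.2)) (x₀, 0) :=
    hφ.contDiffAt.continuousAt.prodMk (by fun_prop)
  simpa [ContinuousAt, hφ.apply_zero hU hZ] using h

lemma eventually_apply_neg (hφ : IsLocalFlow U Z x₀ φ) :
    ∀ᶠ p in 𝓝 (x₀, (0 : ℝ)), φ (φ p, -p.2) = p.1 := by
  filter_upwards [hφ.eventually_arc, (hφ.tendsto_neg hU hZ).eventually hφ.eventually_arc]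
    with p hp hp'
  have hback : Arc U (-p.2 • Z) (φ p) p.1 := by simpa using hp.symm
  exact hp'.unique hU (hZ.const_smul _) hback

lemma exists_pos_hasDerivWithinAt (hφ : IsLocalFlow U Z x₀ φ) :
    ∃ T > 0, HasDerivWithinAt (fun s : ℝ => φ (x₀, s * T)) (T • Z x₀) (Icc 0 1) 0 := by
  have htime : Tendsto (fun t : ℝ => (x₀, t)) (𝓝 0) (𝓝 (x₀, 0)) :=
    (Continuous.prodMk_right x₀).tendsto _
  obtain ⟨δ, hδ, harc⟩ := Metric.eventually_nhds_iff.1 (htime.eventually hφ.eventually_arc)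
  have hT : 0 < δ / 2 := half_pos hδ
  have hsmall : ∀ s ∈ Icc (0 : ℝ) 1, dist (s * (δ / 2)) 0 < δ := fun s hs => by
    rw [dist_zero_right, Real.norm_of_nonneg (mul_nonneg hs.1 hT.le)]
    nlinarith [hs.2]
  obtain ⟨γ, hγ0, -, hγU, hγ⟩ := harc (hsmall 1 (by simp))
  rw [one_mul] at hγ
  have hγ_eq : ∀ s ∈ Icc (0 : ℝ) 1, φ (x₀, s * (δ / 2)) = γ s := fun s hs => by
    have hγs : Arc U ((s * (δ / 2)) • Z) x₀ (γ s) := by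
      simpa [hγ0, smul_smul] using arc_of_isIntegralCurveOn hγU hγ (s := 0) (by simp) hs
    exact (harc (hsmall s hs)).unique hU (hZ.const_smul _) hγs
  have hderiv := (hγ 0 (by simp)).congr hγ_eq (hγ_eq 0 (by simp))
  rw [hγ0] at hderiv
  exact ⟨δ / 2, hT, hderiv⟩

lemma fderiv_apply_zero_one (hφ : IsLocalFlow U Z x₀ φ) : fderiv ℝ φ (x₀, 0) (0, 1) = Z x₀ := by
  obtain ⟨T, hT, hderiv⟩ := hφ.exists_pos_hasDerivWithinAt hU hZ
  have hline : HasDerivAt (fun s : ℝ => (x₀, s * T)) ((0 : V), T) 0 :=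
    (hasDerivAt_const _ _).prodMk (hasDerivAt_mul_const T)
  have hφ' : HasFDerivAt φ (fderiv ℝ φ (x₀, 0)) (x₀, 0 * T) := by simpa using hφ.hasFDerivAt
  have heq : fderiv ℝ φ (x₀, 0) (0, T) = T • Z x₀ :=
    (uniqueDiffOn_Icc zero_lt_one 0 (by simp)).eq_deriv _
      (hφ'.comp_hasDerivAt (0 : ℝ) hline).hasDerivWithinAt hderiv
  rw [show ((0 : V), T) = T • ((0 : V), (1 : ℝ)) by simp, map_smul] at heq
  exact smul_right_injective V hT.ne' heq

lemma fderiv_apply_prod_zero (hφ : IsLocalFlow U Z x₀ φ) (v : V) :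
    fderiv ℝ φ (x₀, 0) (v, 0) = v := by
  have hid : (fun x : V => φ (x, 0)) =ᶠ[𝓝 x₀] id :=
    hφ.eventually_isLocalFlow.mono fun x hx => hx.apply_zero hU hZ
  have hcomp : HasFDerivAt (fun x : V => φ (x, 0)) (fderiv ℝ φ (x₀, 0) ∘L .inl ℝ V ℝ) x₀ :=
    hφ.hasFDerivAt.comp x₀ (hasFDerivAt_prodMk_left x₀ (0 : ℝ))
  exact congr($(hcomp.unique ((hasFDerivAt_id x₀).congr_of_eventuallyEq hid)) v)

lemma fderiv_apply (hφ : IsLocalFlow U Z x₀ φ) (p : V × ℝ) :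
    fderiv ℝ φ (x₀, 0) p = p.1 + p.2 • Z x₀ := by
  rw [← Prod.fst_add_snd p, map_add, hφ.fderiv_apply_prod_zero hU hZ,
    show ((0 : V), p.2) = p.2 • ((0 : V), (1 : ℝ)) by simp, map_smul,
    hφ.fderiv_apply_zero_one hU hZ]
  simp

lemma hasDerivAt_time (hφ : IsLocalFlow U Z x₀ φ) :
    HasDerivAt (fun t : ℝ => φ (x₀, t)) (Z x₀) 0 := by
  have h := hφ.hasFDerivAt.comp_hasDerivAt (0 : ℝ)
    ((hasDerivAt_const (0 : ℝ) x₀).prodMk (hasDerivAt_id (0 : ℝ)))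
  rwa [hφ.fderiv_apply_zero_one hU hZ] at h

lemma fderiv_fderiv_apply_prod_zero (hφ : IsLocalFlow U Z x₀ φ) (p : V × ℝ) (v : V) :
    fderiv ℝ (fderiv ℝ φ) (x₀, 0) p (v, 0) = p.2 • fderiv ℝ Z x₀ v := by
  have hsymm : IsSymmSndFDerivAt ℝ φ (x₀, 0) := hφ.contDiffAt.isSymmSndFDerivAt (by simp)
  have hZ₀ : DifferentiableAt ℝ Z x₀ :=
    (hZ.contDiffAt (hU.mem_nhds hφ.mem)).differentiableAt one_ne_zero
  have heq : (fun x : V => fderiv ℝ φ (x, 0) p) =ᶠ[𝓝 x₀] fun x => p.1 + p.2 • Z x :=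
    hφ.eventually_isLocalFlow.mono fun x hx => hx.fderiv_apply hU hZ p
  have hleft : HasFDerivAt (fun x : V => fderiv ℝ φ (x, 0))
      (fderiv ℝ (fderiv ℝ φ) (x₀, 0) ∘L .inl ℝ V ℝ) x₀ :=
    (hφ.hasFDerivAt_fderiv).comp x₀ (hasFDerivAt_prodMk_left x₀ (0 : ℝ))
  have hright := ((hZ₀.hasFDerivAt.const_smul p.2).const_add p.1).congr_of_eventuallyEq heq
  rw [hsymm.eq]
  simpa using congr($((hleft.clm_apply (hasFDerivAt_const p x₀)).unique hright) v)

theorem hasDerivAt_pullback (hφ : IsLocalFlow U Z x₀ φ) {W : V → V}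
    (hW : DifferentiableAt ℝ W x₀) :
    HasDerivAt (fun t : ℝ => fderiv ℝ φ (φ (x₀, t), -t) (W (φ (x₀, t)), 0))
      (VectorField.lieBracket ℝ Z W x₀) 0 := by
  have hpoint := hφ.hasDerivAt_time hU hZ
  have hzero := hφ.apply_zero hU hZ
  have hlin : HasDerivAt (fun t : ℝ => fderiv ℝ φ (φ (x₀, t), -t))
      (fderiv ℝ (fderiv ℝ φ) (x₀, 0) (Z x₀, -1)) 0 := by
    refine HasFDerivAt.comp_hasDerivAt (0 : ℝ) ?_ (hpoint.prodMk (hasDerivAt_neg 0))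
    simpa [hzero] using hφ.hasFDerivAt_fderiv
  have hvec : HasDerivAt (fun t : ℝ => (W (φ (x₀, t)), (0 : ℝ))) (fderiv ℝ W x₀ (Z x₀), 0) 0 := by
    refine HasDerivAt.prodMk (HasFDerivAt.comp_hasDerivAt (0 : ℝ) ?_ hpoint) (hasDerivAt_const _ _)
    simpa [hzero] using hW.hasFDerivAt
  refine (hlin.clm_apply hvec).congr_deriv ?_
  rw [hzero, neg_zero, hφ.fderiv_fderiv_apply_prod_zero hU hZ, hφ.fderiv_apply hU hZ,
    VectorField.lieBracket_eq]
  simp [sub_eq_neg_add]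

lemma eventually_fderiv_comp_fderiv (hφ : IsLocalFlow U Z x₀ φ) :
    ∀ᶠ p in 𝓝 (x₀, (0 : ℝ)), (fderiv ℝ φ (φ p, -p.2) ∘L .inl ℝ V ℝ) ∘L
      (fderiv ℝ φ p ∘L .inl ℝ V ℝ) = .id ℝ V := by
  filter_upwards [(hφ.eventually_apply_neg hU hZ).eventually_nhds, hφ.eventually_differentiableAt,
    (hφ.tendsto_neg hU hZ).eventually hφ.eventually_differentiableAt] with p hinv hd hd'
  have hmk : Tendsto (fun x : V => (x, p.2)) (𝓝 p.1) (𝓝 p) :=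
    (Continuous.prodMk_left p.2).tendsto _
  have hid : (fun x : V => φ (φ (x, p.2), -p.2)) =ᶠ[𝓝 p.1] id := hmk.eventually hinv
  have hforward : HasFDerivAt (fun x : V => φ (x, p.2)) (fderiv ℝ φ p ∘L .inl ℝ V ℝ) p.1 :=
    hd.hasFDerivAt.comp p.1 (hasFDerivAt_prodMk_left p.1 p.2)
  have hbackward : HasFDerivAt (fun x : V => φ (x, -p.2))
      (fderiv ℝ φ (φ p, -p.2) ∘L .inl ℝ V ℝ) (φ p) :=
    hd'.hasFDerivAt.comp (φ p) (hasFDerivAt_prodMk_left (φ p) (-p.2))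
  have hcomp := HasFDerivAt.comp (f := fun x : V => φ (x, p.2)) p.1 hbackward hforward
  exact hcomp.unique ((hasFDerivAt_id p.1).congr_of_eventuallyEq hid)

lemma eventually_surjective_fderiv (hφ : IsLocalFlow U Z x₀ φ) :
    ∀ᶠ p in 𝓝 (x₀, (0 : ℝ)), Function.Surjective (fderiv ℝ φ p ∘L .inl ℝ V ℝ) := by
  filter_upwards [hφ.eventually_apply_neg hU hZ,
    (hφ.tendsto_neg hU hZ).eventually (hφ.eventually_fderiv_comp_fderiv hU hZ)] with p hinv hcomp v
  rw [hinv, neg_neg] at hcomp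
  exact ⟨_, congr($hcomp v)⟩

end Unique

end IsLocalFlow

end LocalFlow

lemma mem_of_hasDerivAt_of_eventually_mem {V : Type*} [NormedAddCommGroup V] [NormedSpace ℝ V]
    {D : Submodule ℝ V} (hD : IsClosed (D : Set V)) {c : ℝ → V} {c' : V} {t₀ : ℝ}
    (hc : HasDerivAt c c' t₀) (hmem : ∀ᶠ t in 𝓝 t₀, c t ∈ D) : c' ∈ D := by
  refine hD.mem_of_tendsto (hasDerivAt_iff_tendsto_slope.1 hc) ?_
  filter_upwards [nhdsWithin_le_nhds hmem] with t ht
  exact D.smul_mem _ (D.sub_mem ht hmem.self_of_nhds)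

/-- A control-affine system on an open subset `dom` of a normed space, with one scalar control for
each of the fields `ctrl i`. -/
structure ControlSystem (V : Type u) (ι : Type*) [NormedAddCommGroup V] [NormedSpace ℝ V] where
  dom : Set V
  drift : V → V
  ctrl : ι → V → V
  isOpen_dom : IsOpen dom
  contDiffOn_drift : ContDiffOn ℝ 2 drift dom
  contDiffOn_ctrl : ∀ i, ContDiffOn ℝ 2 (ctrl i) dom

namespace ControlSystem

variable {V : Type u} {ι : Type*} [NormedAddCommGroup V] [NormedSpace ℝ V]
  {S : ControlSystem V ι} {x y z : V}

lemma contDiffOn_one_ctrl (i : ι) : ContDiffOn ℝ 1 (S.ctrl i) S.dom :=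
  (S.contDiffOn_ctrl i).of_le (by norm_num)

variable (S) in
/-- `S.Chain ε n x y`: the point `y` is reached from `x` along `n` consecutive arcs on `[0, 1]` of
fields `ε • drift + θ • ctrl i`. For `ε > 0` this is a trajectory of duration `n * ε` whose
controls are the `θ / ε`, one index `i` at a time. -/
inductive Chain (ε : ℝ) : ℕ → V → V → Prop
  | nil {x : V} (hx : x ∈ S.dom) : Chain ε 0 x x
  | cons {n : ℕ} {x y z : V} (i : ι) (θ : ℝ) (h : Arc S.dom (ε • S.drift + θ • S.ctrl i) x y)
      (h' : Chain ε n y z) : Chain ε (n + 1) x z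

lemma Chain.trans {ε : ℝ} {n m : ℕ} (h : S.Chain ε n x y) (h' : S.Chain ε m y z) :
    S.Chain ε (n + m) x z := by
  induction h with
  | nil => simpa using h'
  | cons i θ h _ ih => rw [Nat.add_right_comm]; exact .cons i θ h (ih h')

lemma Chain.single {ε : ℝ} (i : ι) (θ : ℝ)
    (h : Arc S.dom (ε • S.drift + θ • S.ctrl i) x y) : S.Chain ε 1 x y :=
  .cons i θ h (.nil h.right_mem)

lemma Chain.right_mem {ε : ℝ} {n : ℕ} (h : S.Chain ε n x y) : y ∈ S.dom := by
  induction h with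
  | nil hx => exact hx
  | cons _ _ _ _ ih => exact ih

variable (S) in
/-- `S.Orbit x y`: the point `y` is reached from `x` by the driftless system. -/
def Orbit (x y : V) : Prop := ∃ n, S.Chain 0 n x y

namespace Orbit

lemma refl (hx : x ∈ S.dom) : S.Orbit x x := ⟨0, .nil hx⟩

lemma trans : S.Orbit x y → S.Orbit y z → S.Orbit x z := by
  rintro ⟨n, h⟩ ⟨m, h'⟩
  exact ⟨n + m, h.trans h'⟩

lemma single (i : ι) (θ : ℝ) (h : Arc S.dom (θ • S.ctrl i) x y) : S.Orbit x y :=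
  ⟨1, .single i θ (by simpa using h)⟩

lemma induction {P : V → V → Prop} (hrefl : ∀ x ∈ S.dom, P x x)
    (hstep : ∀ (x y z : V) (i : ι) (θ : ℝ), Arc S.dom (θ • S.ctrl i) x y → P y z → P x z)
    (h : S.Orbit x y) : P x y := by
  obtain ⟨n, h⟩ := h
  induction h with
  | nil hx => exact hrefl _ hx
  | cons i θ h _ ih => exact hstep _ _ _ i θ (by simpa using h) ih

lemma symm (h : S.Orbit x y) : S.Orbit y x := by
  refine induction (P := fun x y => S.Orbit y x) (fun _ => refl) (fun x y z i θ h h' => ?_) h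
  exact h'.trans (.single i (-θ) (by simpa using h.symm))

lemma right_mem (h : S.Orbit x y) : y ∈ S.dom := h.choose_spec.right_mem

end Orbit

variable (S) in
/-- A way of steering from `x` to `y` with the driftless system that can be varied: a family of
chains of fixed length, from each point near `x`, for each small drift coefficient and each
parameter near `base`, whose end point `endpoint (x', ε, η)` is strictly differentiable at
`(x, 0, base)`. -/
structure Maneuver (x y : V) where
  length : ℕ
  length_pos : 0 < length
  Param : Type
  [normedAddCommGroup : NormedAddCommGroup Param]
  [normedSpace : NormedSpace ℝ Param]
  [completeSpace : CompleteSpace Param]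
  base : Param
  endpoint : V × ℝ × Param → V
  endpointDeriv : V × ℝ × Param →L[ℝ] V
  hasStrictFDerivAt : HasStrictFDerivAt endpoint endpointDeriv (x, 0, base)
  endpoint_base : endpoint (x, 0, base) = y
  eventually_chain : ∀ᶠ q in 𝓝 (x, (0 : ℝ), base), S.Chain q.2.1 length q.1 (endpoint q)

namespace Maneuver

attribute [instance] normedAddCommGroup normedSpace completeSpace

/-- The partial derivative of the end point of a maneuver in its initial point. -/
noncomputable def stateDeriv (M : S.Maneuver x y) : V →L[ℝ] V :=
  M.endpointDeriv ∘L .inl ℝ V (ℝ × M.Param)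

/-- The partial derivative of the end point of a maneuver in its parameter. -/
noncomputable def paramDeriv (M : S.Maneuver x y) : M.Param →L[ℝ] V :=
  M.endpointDeriv ∘L .inr ℝ V (ℝ × M.Param) ∘L .inr ℝ ℝ M.Param

/-- The infinitesimal displacements of the end point of a maneuver that its parameter allows. -/
noncomputable def reach (M : S.Maneuver x y) : Submodule ℝ V := M.paramDeriv.range

/-- The maneuver `M₁` followed by the maneuver `M₂`, with independent parameters. -/
noncomputable def comp (M₁ : S.Maneuver x y) (M₂ : S.Maneuver y z) : S.Maneuver x z :=
  let first : V × ℝ × M₁.Param × M₂.Param →L[ℝ] V × ℝ × M₁.Param :=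
    (ContinuousLinearMap.id ℝ V).prodMap ((ContinuousLinearMap.id ℝ ℝ).prodMap (.fst ℝ _ _))
  let rest : V × ℝ × M₁.Param × M₂.Param →L[ℝ] ℝ × M₂.Param :=
    (ContinuousLinearMap.id ℝ ℝ).prodMap (.snd ℝ _ _) ∘L .snd ℝ V _
  have hfirst : HasStrictFDerivAt (fun q => (M₁.endpoint (first q), rest q))
      ((M₁.endpointDeriv ∘L first).prod rest) (x, 0, M₁.base, M₂.base) :=
    (M₁.hasStrictFDerivAt.comp (f := first) (x, 0, M₁.base, M₂.base)
      first.hasStrictFDerivAt).prodMk rest.hasStrictFDerivAt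
  have hmid : (M₁.endpoint (first (x, 0, M₁.base, M₂.base)), rest (x, 0, M₁.base, M₂.base)) =
      (y, 0, M₂.base) := Prod.ext M₁.endpoint_base rfl
  { length := M₁.length + M₂.length
    length_pos := Nat.add_pos_left M₁.length_pos _
    Param := M₁.Param × M₂.Param
    base := (M₁.base, M₂.base)
    endpoint := fun q => M₂.endpoint (M₁.endpoint (first q), rest q)
    endpointDeriv := M₂.endpointDeriv ∘L (M₁.endpointDeriv ∘L first).prod rest
    hasStrictFDerivAt :=
      (show HasStrictFDerivAt M₂.endpoint _ _ from hmid ▸ M₂.hasStrictFDerivAt).comp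
        (x, 0, M₁.base, M₂.base) hfirst
    endpoint_base := (congrArg M₂.endpoint hmid).trans M₂.endpoint_base
    eventually_chain := by
      have hcont := hfirst.continuousAt.tendsto
      rw [hmid] at hcont
      filter_upwards [(first.continuous.tendsto (x, 0, M₁.base, M₂.base)).eventually
        M₁.eventually_chain, hcont.eventually M₂.eventually_chain] with q h₁ h₂ using h₁.trans h₂ }

lemma stateDeriv_comp (M₁ : S.Maneuver x y) (M₂ : S.Maneuver y z) :
    (M₁.comp M₂).stateDeriv = M₂.stateDeriv ∘L M₁.stateDeriv :=
  ContinuousLinearMap.ext fun _ => rfl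

lemma paramDeriv_comp_apply (M₁ : S.Maneuver x y) (M₂ : S.Maneuver y z)
    (η : M₁.Param × M₂.Param) :
    (M₁.comp M₂).paramDeriv η = M₂.stateDeriv (M₁.paramDeriv η.1) + M₂.paramDeriv η.2 := by
  change M₂.endpointDeriv (M₁.paramDeriv η.1, 0, η.2) =
    M₂.endpointDeriv (M₁.paramDeriv η.1, 0) + M₂.endpointDeriv (0, 0, η.2)
  simp [← map_add]

lemma reach_comp (M₁ : S.Maneuver x y) (M₂ : S.Maneuver y z) :
    (M₁.comp M₂).reach = M₁.reach.map (M₂.stateDeriv : V →ₗ[ℝ] V) ⊔ M₂.reach := by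
  refine le_antisymm ?_ (sup_le ?_ ?_)
  · rintro _ ⟨η, rfl⟩
    exact (paramDeriv_comp_apply M₁ M₂ η).symm ▸
      Submodule.add_mem_sup ⟨_, ⟨η.1, rfl⟩, rfl⟩ ⟨η.2, rfl⟩
  · rintro _ ⟨_, ⟨η, rfl⟩, rfl⟩
    exact ⟨(η, 0), by simpa using paramDeriv_comp_apply M₁ M₂ (η, 0)⟩
  · rintro _ ⟨η, rfl⟩
    exact ⟨(0, η), by simpa using paramDeriv_comp_apply M₁ M₂ (0, η)⟩

theorem eventually_chain_of_reach_eq_top [CompleteSpace V] (M : S.Maneuver x y)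
    (hM : M.reach = ⊤) : ∀ᶠ q in 𝓝 ((0 : ℝ), y), S.Chain q.1 M.length x q.2 := by
  let E := M.endpointDeriv ∘L .inr ℝ V (ℝ × M.Param)
  have hright : HasStrictFDerivAt (fun p : ℝ × M.Param => (x, p)) (.inr ℝ V (ℝ × M.Param))
      (0, M.base) := (hasStrictFDerivAt_const x _).prodMk (hasStrictFDerivAt_id _)
  have hend : HasStrictFDerivAt (fun p : ℝ × M.Param => (p.1, M.endpoint (x, p)))
      ((ContinuousLinearMap.fst ℝ ℝ M.Param).prod E) (0, M.base) :=
    hasStrictFDerivAt_fst.prodMk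
      (M.hasStrictFDerivAt.comp (f := fun p : ℝ × M.Param => (x, p)) (0, M.base) hright)
  have hsurj : ((ContinuousLinearMap.fst ℝ ℝ M.Param).prod E).range = ⊤ := by
    refine LinearMap.range_eq_top.2 fun w => ?_
    obtain ⟨η, hη⟩ : w.2 - E (w.1, 0) ∈ M.reach := hM ▸ Submodule.mem_top
    have hη' : E (0, η) = w.2 - E (w.1, 0) := hη
    refine ⟨(w.1, η), Prod.ext rfl ?_⟩
    change E (w.1, η) = w.2
    rw [← Prod.fst_add_snd (w.1, η), map_add, hη', add_sub_cancel]
  rw [← show (0, M.endpoint (x, 0, M.base)) = ((0 : ℝ), y) from Prod.ext rfl M.endpoint_base,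
    ← hend.map_nhds_eq_of_surj hsurj, eventually_map]
  exact hright.continuousAt.eventually M.eventually_chain

end Maneuver

theorem exists_isLocalFlow_maneuver [CompleteSpace V] (i : ι) (hx : x ∈ S.dom) :
    ∃ φ, IsLocalFlow S.dom (S.ctrl i) x φ ∧ ∀ᶠ p in 𝓝 (x, (0 : ℝ)), ∃ M : S.Maneuver p.1 (φ p),
      M.stateDeriv = fderiv ℝ φ p ∘L .inl ℝ V ℝ ∧ fderiv ℝ φ p (0, 1) ∈ M.reach := by
  let F : V × ℝ × ℝ → V := fun q => q.2.1 • S.drift q.1 + q.2.2 • S.ctrl i q.1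
  have hF : ContDiffOn ℝ 2 F (S.dom ×ˢ univ) := by
    have hfst : MapsTo Prod.fst (S.dom ×ˢ (univ : Set (ℝ × ℝ))) S.dom := fun q hq => hq.1
    exact (contDiff_snd.fst.contDiffOn.smul
      (S.contDiffOn_drift.comp contDiff_fst.contDiffOn hfst)).add
      (contDiff_snd.snd.contDiffOn.smul
      ((S.contDiffOn_ctrl i).comp contDiff_fst.contDiffOn hfst))
  obtain ⟨G, hG, harc⟩ := exists_contDiffAt_arc (F := F) (r := 2) (l := 0) S.isOpen_dom two_ne_zero
    (by exact_mod_cast hF) (fun x _ => by simp [F]) hx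
  let j : V × ℝ →L[ℝ] V × ℝ × ℝ := (ContinuousLinearMap.id ℝ V).prodMap (.inr ℝ ℝ ℝ)
  have hj : Tendsto j (𝓝 (x, 0)) (𝓝 (x, 0)) := j.continuous.tendsto _
  refine ⟨G ∘ j, ⟨hG.comp (x, (0 : ℝ)) j.contDiff.contDiffAt, ?_⟩, ?_⟩
  · filter_upwards [hj.eventually harc] with p hp
    have hfield : (fun y => F (y, (j p).2)) = p.2 • S.ctrl i := by ext; simp [F, j]
    rwa [hfield] at hp
  · filter_upwards [hj.eventually harc.eventually_nhds, hj.eventually (hG.eventually (by simp))]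
      with p hp hp'
    have hstrict : HasStrictFDerivAt G (fderiv ℝ G (j p)) (j p) :=
      hp'.hasStrictFDerivAt two_ne_zero
    have hderiv : fderiv ℝ (G ∘ j) p = fderiv ℝ G (j p) ∘L j :=
      (hstrict.hasFDerivAt.comp p (f := j) j.hasFDerivAt).fderiv
    refine ⟨⟨1, one_pos, ℝ, p.2, G, fderiv ℝ G (j p), hstrict, rfl, ?_⟩, ?_, (1 : ℝ), ?_⟩
    · filter_upwards [hp] with q hq using .single i q.2.2 hq
    · rw [hderiv]
      rfl
    · rw [hderiv]
      rfl

variable (S) in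
/-- The directions in which the driftless system can be steered at `x` along loops whose effect on
the initial point is the identity to first order. -/
noncomputable def directions (x : V) : Submodule ℝ V :=
  sSup {R | ∃ M : S.Maneuver x x, M.stateDeriv = .id ℝ V ∧ M.reach = R}

lemma reach_le_directions {M : S.Maneuver x x} (hM : M.stateDeriv = .id ℝ V) :
    M.reach ≤ S.directions x :=
  le_sSup ⟨M, hM, rfl⟩

section Complete

variable [CompleteSpace V]

lemma exists_loop (i : ι) (hx : x ∈ S.dom) :
    ∃ M : S.Maneuver x x, M.stateDeriv = .id ℝ V ∧ S.ctrl i x ∈ M.reach := by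
  obtain ⟨φ, hφ, hman⟩ := exists_isLocalFlow_maneuver i hx
  have hC1 := contDiffOn_one_ctrl (S := S) i
  have hid : fderiv ℝ φ (x, 0) ∘L .inl ℝ V ℝ = .id ℝ V :=
    ContinuousLinearMap.ext (hφ.fderiv_apply_prod_zero S.isOpen_dom hC1)
  have hbase := hman.self_of_nhds
  rwa [hid, hφ.fderiv_apply_zero_one S.isOpen_dom hC1, hφ.apply_zero S.isOpen_dom hC1] at hbase

lemma ctrl_mem_directions (i : ι) (hx : x ∈ S.dom) : S.ctrl i x ∈ S.directions x := by
  obtain ⟨M, hM, hmem⟩ := exists_loop i hx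
  exact reach_le_directions hM hmem

lemma eventually_exists_surjective_maneuver (i : ι) (hx : x ∈ S.dom) :
    ∀ᶠ p in 𝓝 (x, (0 : ℝ)), ∀ z, Arc S.dom (p.2 • S.ctrl i) p.1 z →
      ∃ M : S.Maneuver p.1 z, Function.Surjective M.stateDeriv := by
  obtain ⟨φ, hφ, hman⟩ := exists_isLocalFlow_maneuver i hx
  have hC1 := contDiffOn_one_ctrl (S := S) i
  filter_upwards [hφ.eventually_surjective_fderiv S.isOpen_dom hC1, hφ.eventually_arc, hman]
    with p hsurj harc ⟨M, hM, _⟩ z hz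
  rw [hz.unique S.isOpen_dom (hC1.const_smul _) harc]
  exact ⟨M, hM ▸ hsurj⟩

lemma exists_maneuver_of_arc {i : ι} {θ : ℝ} (h : Arc S.dom (θ • S.ctrl i) x y) :
    ∃ M : S.Maneuver x y, Function.Surjective M.stateDeriv := by
  obtain ⟨γ, rfl, rfl, hγU, hγ⟩ := h
  refine isPreconnected_Icc.induction₂' (s := Icc (0 : ℝ) 1)
    (fun s t => ∃ M : S.Maneuver (γ s) (γ t), Function.Surjective M.stateDeriv)
    (fun s hs => ?_) ?_ (by simp) (by simp)
  · have hlocal := eventually_exists_surjective_maneuver i (hγU hs)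
    have hcont : ContinuousWithinAt γ (Icc 0 1) s := (hγ s hs).continuousWithinAt
    have hforward : Tendsto (fun t : ℝ => (γ s, (t - s) * θ)) (𝓝[Icc 0 1] s) (𝓝 (γ s, 0)) := by
      have h : ContinuousAt (fun t : ℝ => (γ s, (t - s) * θ)) s := by fun_prop
      simpa [ContinuousWithinAt] using h.continuousWithinAt (s := Icc 0 1)
    have hbackward : Tendsto (fun t : ℝ => (γ t, (s - t) * θ)) (𝓝[Icc 0 1] s) (𝓝 (γ s, 0)) := by
      have h : ContinuousAt (fun t : ℝ => (s - t) * θ) s := by fun_prop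
      simpa [ContinuousWithinAt] using hcont.prodMk (h.continuousWithinAt (s := Icc 0 1))
    filter_upwards [hforward.eventually hlocal, hbackward.eventually hlocal, self_mem_nhdsWithin]
      with t h₁ h₂ ht
    have harc {s t : ℝ} (hs : s ∈ Icc (0 : ℝ) 1) (ht : t ∈ Icc (0 : ℝ) 1) :
        Arc S.dom (((t - s) * θ) • S.ctrl i) (γ s) (γ t) := by
      simpa only [smul_smul] using arc_of_isIntegralCurveOn hγU hγ hs ht
    exact ⟨h₁ _ (harc hs ht), h₂ _ (harc ht hs)⟩
  · rintro r s t - - - ⟨M₁, h₁⟩ ⟨M₂, h₂⟩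
    exact ⟨M₁.comp M₂, M₁.stateDeriv_comp M₂ ▸ h₂.comp h₁⟩

lemma Orbit.exists_maneuver [Nonempty ι] (h : S.Orbit x y) :
    ∃ M : S.Maneuver x y, Function.Surjective M.stateDeriv := by
  refine Orbit.induction (P := fun x y => ∃ M : S.Maneuver x y, Function.Surjective M.stateDeriv)
    (fun x hx => ?_) ?_ h
  · obtain ⟨M, hM, -⟩ := exists_loop (Classical.arbitrary ι) hx
    exact ⟨M, hM ▸ Function.surjective_id⟩
  · rintro x y z i θ harc ⟨M₂, h₂⟩
    obtain ⟨M₁, h₁⟩ := exists_maneuver_of_arc harc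
    exact ⟨M₁.comp M₂, M₁.stateDeriv_comp M₂ ▸ h₂.comp h₁⟩

end Complete

section FiniteDimensional

variable [FiniteDimensional ℝ V]

lemma exists_loop_reach_eq_directions [Nonempty ι] (hx : x ∈ S.dom) :
    ∃ M : S.Maneuver x x, M.stateDeriv = .id ℝ V ∧ M.reach = S.directions x := by
  have := FiniteDimensional.complete ℝ V
  refine CompleteLattice.WellFoundedGT.isSupClosedCompact (Submodule ℝ V) inferInstance
    {R | ∃ M : S.Maneuver x x, M.stateDeriv = .id ℝ V ∧ M.reach = R} ?_ ?_
  · obtain ⟨M, hM, -⟩ := exists_loop (Classical.arbitrary ι) hx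
    exact ⟨M.reach, M, hM, rfl⟩
  · rintro _ ⟨M₁, h₁, rfl⟩ _ ⟨M₂, h₂, rfl⟩
    refine ⟨M₁.comp M₂, ?_, ?_⟩
    · rw [Maneuver.stateDeriv_comp, h₁, h₂, ContinuousLinearMap.id_comp]
    · rw [Maneuver.reach_comp, h₂]
      exact congrArg (· ⊔ M₂.reach) (Submodule.map_id M₁.reach)

theorem lieBracket_mem_directions (i : ι) {W : V → V} (hW : ∀ z ∈ S.dom, W z ∈ S.directions z)
    (hx : x ∈ S.dom) (hWx : DifferentiableAt ℝ W x) :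
    VectorField.lieBracket ℝ (S.ctrl i) W x ∈ S.directions x := by
  have : Nonempty ι := ⟨i⟩
  have := FiniteDimensional.complete ℝ V
  obtain ⟨φ, hφ, hman⟩ := exists_isLocalFlow_maneuver i hx
  have hC1 := contDiffOn_one_ctrl (S := S) i
  have hline : Tendsto (fun t : ℝ => (x, t)) (𝓝 0) (𝓝 (x, 0)) :=
    (Continuous.prodMk_right x).tendsto _
  refine mem_of_hasDerivAt_of_eventually_mem (Submodule.closed_of_finiteDimensional _)
    (hφ.hasDerivAt_pullback S.isOpen_dom hC1 hWx) ?_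
  filter_upwards [hline.eventually hman, hline.eventually hφ.eventually_arc,
    hline.eventually ((hφ.tendsto_neg S.isOpen_dom hC1).eventually hman),
    hline.eventually (hφ.eventually_apply_neg S.isOpen_dom hC1),
    hline.eventually (hφ.eventually_fderiv_comp_fderiv S.isOpen_dom hC1)]
    with t ⟨M₁, h₁, _⟩ harc hback hinv hcomp
  rw [hinv] at hback
  obtain ⟨M₂, h₂, -⟩ := hback
  obtain ⟨L, hL, hreach⟩ := exists_loop_reach_eq_directions harc.right_mem
  refine reach_le_directions (M := (M₁.comp L).comp M₂) ?_ ?_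
  · rw [Maneuver.stateDeriv_comp, Maneuver.stateDeriv_comp, h₁, hL, h₂,
      ContinuousLinearMap.id_comp, hcomp]
  · rw [Maneuver.reach_comp, Maneuver.reach_comp, hreach, h₂]
    exact Submodule.mem_sup_left
      ⟨W (φ (x, t)), Submodule.mem_sup_right (hW _ harc.right_mem), rfl⟩

theorem exists_chain_of_orbit [Nonempty ι] (hxz : S.Orbit x z) (hzy : S.Orbit z y)
    (hz : S.directions z = ⊤) : ∃ ℓ, 0 < ℓ ∧ ∀ᶠ q in 𝓝 ((0 : ℝ), y), S.Chain q.1 ℓ x q.2 := by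
  have := FiniteDimensional.complete ℝ V
  obtain ⟨M₁, -⟩ := hxz.exists_maneuver
  obtain ⟨M₂, hM₂⟩ := hzy.exists_maneuver
  obtain ⟨L, -, hL⟩ := exists_loop_reach_eq_directions hxz.right_mem
  let M := (M₁.comp L).comp M₂
  refine ⟨M.length, M.length_pos, M.eventually_chain_of_reach_eq_top ?_⟩
  rw [Maneuver.reach_comp, Maneuver.reach_comp, hL, hz, sup_top_eq, Submodule.map_top,
    LinearMap.range_eq_top.2 hM₂, top_sup_eq]

theorem eventually_orbit [Nonempty ι] (hx : x ∈ S.dom) (hdir : S.directions x = ⊤) :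
    ∀ᶠ y in 𝓝 x, S.Orbit x y := by
  obtain ⟨ℓ, -, hchain⟩ := exists_chain_of_orbit (.refl hx) (.refl hx) hdir
  filter_upwards [((Continuous.prodMk_right (0 : ℝ)).tendsto x).eventually hchain] with y hy
    using ⟨ℓ, hy⟩

end FiniteDimensional

end ControlSystem

end AffineControl

namespace StatLin

open Filter Topology Set AffineControl
open scoped Matrix.Norms.L2Operator

variable {n : ℕ}

section Jacobian

variable {V W : (Fin n → ℝ) → Fin n → ℝ} {m : Fin n → ℝ}

/-- The continuous linear map sending an endomorphism of `ℝⁿ` to its matrix. -/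
noncomputable def toMatrixCLM (n : ℕ) :
    ((Fin n → ℝ) →L[ℝ] (Fin n → ℝ)) →L[ℝ] Matrix (Fin n) (Fin n) ℝ :=
  LinearMap.toContinuousLinearMap
    (LinearMap.toMatrix'.toLinearMap ∘ₗ ContinuousLinearMap.coeLM ℝ)

lemma jacobian_apply : jacobian W m = toMatrixCLM n (fderiv ℝ W m) := rfl

lemma toMatrixCLM_comp (A B : (Fin n → ℝ) →L[ℝ] (Fin n → ℝ)) :
    toMatrixCLM n (A ∘L B) = toMatrixCLM n A * toMatrixCLM n B :=
  LinearMap.toMatrix'_comp _ _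

lemma contDiffAt_jacobian {r s : WithTop ℕ∞} (hW : ContDiffAt ℝ s W m) (hrs : r + 1 ≤ s) :
    ContDiffAt ℝ r (jacobian W) m :=
  (toMatrixCLM n).contDiff.contDiffAt.comp m (hW.fderiv_right hrs)

lemma hasFDerivAt_jacobian (hW : ContDiffAt ℝ 2 W m) :
    HasFDerivAt (jacobian W) (toMatrixCLM n ∘L fderiv ℝ (fderiv ℝ W) m) m :=
  (toMatrixCLM n).hasFDerivAt.comp m
    ((hW.fderiv_right (m := 1) (by norm_num)).differentiableAt one_ne_zero).hasFDerivAt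

lemma fderiv_lieBracket {E : Type*} [NormedAddCommGroup E] [NormedSpace ℝ E] {V W : E → E} {x : E}
    (hV : ContDiffAt ℝ 2 V x) (hW : ContDiffAt ℝ 2 W x) :
    fderiv ℝ (VectorField.lieBracket ℝ V W) x =
      fderiv ℝ (fderiv ℝ W) x (V x) + fderiv ℝ W x ∘L fderiv ℝ V x
        - (fderiv ℝ (fderiv ℝ V) x (W x) + fderiv ℝ V x ∘L fderiv ℝ W x) := by
  have hV₁ := (hV.differentiableAt two_ne_zero).hasFDerivAt
  have hW₁ := (hW.differentiableAt two_ne_zero).hasFDerivAt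
  have hV₂ := ((hV.fderiv_right (m := 1) (by norm_num)).differentiableAt one_ne_zero).hasFDerivAt
  have hW₂ := ((hW.fderiv_right (m := 1) (by norm_num)).differentiableAt one_ne_zero).hasFDerivAt
  refine ((hW₂.clm_apply hV₁).sub (hV₂.clm_apply hW₁)).fderiv.trans ?_
  ext v
  simp [(hV.isSymmSndFDerivAt (by simp)).eq v (W x), (hW.isSymmSndFDerivAt (by simp)).eq v (V x),
    add_comm]

lemma jacobian_lieBracket (hV : ContDiffAt ℝ 2 V m) (hW : ContDiffAt ℝ 2 W m) :
    jacobian (VectorField.lieBracket ℝ V W) m =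
      fderiv ℝ (jacobian W) m (V m) + jacobian W m * jacobian V m
        - (fderiv ℝ (jacobian V) m (W m) + jacobian V m * jacobian W m) := by
  rw [(hasFDerivAt_jacobian hV).fderiv, (hasFDerivAt_jacobian hW).fderiv]
  simp only [jacobian_apply, fderiv_lieBracket hV hW, map_sub, map_add, toMatrixCLM_comp,
    ContinuousLinearMap.comp_apply]

end Jacobian

section Lift

variable {V W : (Fin n → ℝ) → Fin n → ℝ} {m : Fin n → ℝ}

/-- The lift `(m, A) ↦ (W(m), DW(m) A)` of a vector field to the bundle of linear frames. -/
noncomputable def lift (W : (Fin n → ℝ) → Fin n → ℝ)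
    (p : (Fin n → ℝ) × Matrix (Fin n) (Fin n) ℝ) : (Fin n → ℝ) × Matrix (Fin n) (Fin n) ℝ :=
  (W p.1, jacobian W p.1 * p.2)

variable {p : (Fin n → ℝ) × Matrix (Fin n) (Fin n) ℝ}

lemma contDiffAt_lift {r s : WithTop ℕ∞} (hW : ContDiffAt ℝ s W p.1) (hrs : r + 1 ≤ s) :
    ContDiffAt ℝ r (lift W) p := by
  have hfst : ContDiffAt ℝ r (fun p : (Fin n → ℝ) × Matrix (Fin n) (Fin n) ℝ => p.1) p :=
    contDiffAt_fst
  exact ((hW.of_le (le_self_add.trans hrs)).comp p hfst).prodMk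
    (((contDiffAt_jacobian hW hrs).comp p hfst).mul contDiffAt_snd)

lemma fderiv_lift_apply (hW : ContDiffAt ℝ 2 W p.1)
    (q : (Fin n → ℝ) × Matrix (Fin n) (Fin n) ℝ) :
    fderiv ℝ (lift W) p q =
      (fderiv ℝ W p.1 q.1, fderiv ℝ (jacobian W) p.1 q.1 * p.2 + jacobian W p.1 * q.2) := by
  have hW₁ := (hW.differentiableAt two_ne_zero).hasFDerivAt
  have hW₂ := (hasFDerivAt_jacobian hW).differentiableAt.hasFDerivAt
  have hlift := (hW₁.comp p hasFDerivAt_fst).prodMk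
    ((hW₂.comp p hasFDerivAt_fst).mul' (hasFDerivAt_snd (p := p)))
  refine (congrArg (· q) (HasFDerivAt.fderiv (f := lift W) hlift)).trans ?_
  simp [add_comm]

lemma lieBracket_lift (hV : ContDiffAt ℝ 2 V p.1) (hW : ContDiffAt ℝ 2 W p.1) :
    VectorField.lieBracket ℝ (lift V) (lift W) p = lift (VectorField.lieBracket ℝ V W) p := by
  simp only [VectorField.lieBracket_eq, fderiv_lift_apply hV, fderiv_lift_apply hW]
  refine Prod.ext rfl ?_
  simp only [lift, Prod.snd_sub, ← VectorField.lieBracket_eq, jacobian_lieBracket hV hW]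
  noncomm_ring

end Lift

section System

variable {d k : ℕ}

/-- The infinitesimal right rotation `(m, A) ↦ (0, A (B - Bᵀ))` of the bundle of linear frames. -/
def rotation (B : Matrix (Fin n) (Fin n) ℝ) (p : (Fin n → ℝ) × Matrix (Fin n) (Fin n) ℝ) :
    (Fin n → ℝ) × Matrix (Fin n) (Fin n) ℝ :=
  (0, p.2 * (B - B.transpose))

/-- The lift `(m, A) ↦ (f₀(m), Df₀(m) A + ½ g(m) g(m)ᵀ A⁻ᵀ)` of the drift of the statistical
linearization along `(m, A) ↦ (m, A Aᵀ)`. -/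
noncomputable def liftedDrift (f₀ : (Fin n → ℝ) → Fin n → ℝ)
    (g : (Fin n → ℝ) → Matrix (Fin n) (Fin d) ℝ)
    (p : (Fin n → ℝ) × Matrix (Fin n) (Fin n) ℝ) : (Fin n → ℝ) × Matrix (Fin n) (Fin n) ℝ :=
  lift f₀ p + (0, (2⁻¹ : ℝ) • (g p.1 * (g p.1).transpose * p.2⁻¹.transpose))

/-- Transposition of matrices as a continuous linear map. -/
noncomputable def transposeCLM (n : ℕ) : Matrix (Fin n) (Fin n) ℝ →L[ℝ] Matrix (Fin n) (Fin n) ℝ :=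
  LinearMap.toContinuousLinearMap (Matrix.transposeLinearEquiv (Fin n) (Fin n) ℝ ℝ).toLinearMap

lemma contDiffAt_inv_transpose {r : WithTop ℕ∞} {A : Matrix (Fin n) (Fin n) ℝ} (hA : IsUnit A) :
    ContDiffAt ℝ r (fun A : Matrix (Fin n) (Fin n) ℝ => A⁻¹.transpose) A := by
  obtain ⟨A, rfl⟩ := hA
  simp only [Matrix.nonsing_inv_eq_ringInverse]
  exact (transposeCLM n).contDiff.contDiffAt.comp _ (contDiffAt_ringInverse ℝ A)

lemma contDiffAt_of_entries {E ι κ : Type*} [NormedAddCommGroup E] [NormedSpace ℝ E] [Fintype ι]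
    [Fintype κ] [DecidableEq κ] {r : WithTop ℕ∞} {x : E} {g : E → Matrix ι κ ℝ}
    (hg : ∀ a b, ContDiffAt ℝ r (fun m => g m a b) x) : ContDiffAt ℝ r g x := by
  let ofCLM : (ι → κ → ℝ) →L[ℝ] Matrix ι κ ℝ :=
    LinearMap.toContinuousLinearMap (Matrix.ofLinearEquiv ℝ).toLinearMap
  exact ofCLM.contDiff.contDiffAt.comp x (contDiffAt_pi.2 fun a => contDiffAt_pi.2 (hg a))

lemma contDiffAt_liftedDrift {f₀ : (Fin n → ℝ) → Fin n → ℝ}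
    {g : (Fin n → ℝ) → Matrix (Fin n) (Fin d) ℝ} {r s : WithTop ℕ∞} {p}
    (hf₀ : ContDiffAt ℝ s f₀ p.1) (hg : ∀ a b, ContDiffAt ℝ r (fun m => g m a b) p.1)
    (hrs : r + 1 ≤ s) (hp : IsUnit p.2) : ContDiffAt ℝ r (liftedDrift f₀ g) p := by
  have hgg : ContDiffAt ℝ r (fun m => g m * (g m).transpose) p.1 := contDiffAt_of_entries
    fun a b => by
      simp only [Matrix.mul_apply, Matrix.transpose_apply]
      exact .sum fun c _ => (hg a c).mul (hg b c)
  exact (contDiffAt_lift hf₀ hrs).add <| contDiffAt_const.prodMk <|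
    ((hgg.comp p contDiffAt_fst).mul
      ((contDiffAt_inv_transpose hp).comp p contDiffAt_snd)).const_smul _

/-- The lift of the statistical linearization to the bundle of linear frames, with the right
rotations as additional control fields. -/
noncomputable def liftedSystem {M : Set (Fin n → ℝ)} (hM : IsOpen M)
    {f₀ : (Fin n → ℝ) → Fin n → ℝ} {f : Fin k → (Fin n → ℝ) → Fin n → ℝ}
    {g : (Fin n → ℝ) → Matrix (Fin n) (Fin d) ℝ} (hf₀ : ContDiffOn ℝ 3 f₀ M)
    (hf : ∀ i, ContDiffOn ℝ ∞ (f i) M) (hg : ∀ a b, ContDiffOn ℝ 2 (fun m => g m a b) M) :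
    ControlSystem ((Fin n → ℝ) × Matrix (Fin n) (Fin n) ℝ)
      (Fin k ⊕ Matrix (Fin n) (Fin n) ℝ) where
  dom := M ×ˢ {A | IsUnit A}
  drift := liftedDrift f₀ g
  ctrl := Sum.elim (fun i => lift (f i)) rotation
  isOpen_dom := hM.prod Units.isOpen
  contDiffOn_drift p hp := by
    have hpM := hM.mem_nhds hp.1
    exact (contDiffAt_liftedDrift (hf₀.contDiffAt hpM) (fun a b => (hg a b).contDiffAt hpM)
      (by norm_num) hp.2).contDiffWithinAt
  contDiffOn_ctrl := by
    rintro (i | B) p hp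
    · exact (contDiffAt_lift ((hf i).contDiffAt (hM.mem_nhds hp.1))
        (by norm_cast)).contDiffWithinAt
    · exact contDiffWithinAt_const.prodMk (contDiffWithinAt_snd.mul contDiffWithinAt_const)

end System

section Rank

/-- The linear map `(v, A) ↦ (v, A + Aᵀ)`. -/
def symmetrize (n : ℕ) : (Fin n → ℝ) × Matrix (Fin n) (Fin n) ℝ →ₗ[ℝ]
    (Fin n → ℝ) × Matrix (Fin n) (Fin n) ℝ :=
  LinearMap.id.prodMap
    (LinearMap.id + (Matrix.transposeLinearEquiv (Fin n) (Fin n) ℝ ℝ).toLinearMap)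

lemma range_symmetrize_le_of_finrank_eq
    {L : Submodule ℝ ((Fin n → ℝ) × Matrix (Fin n) (Fin n) ℝ)}
    (hL : L ≤ LinearMap.range (symmetrize n))
    (hrank : Module.finrank ℝ L = n + n * (n + 1) / 2) :
    LinearMap.range (symmetrize n) ≤ L := by
  let ofSym2 : (Sym2 (Fin n) → ℝ) →ₗ[ℝ] Matrix (Fin n) (Fin n) ℝ :=
    { toFun := fun φ => .of fun i j => φ s(i, j)
      map_add' := fun _ _ => rfl
      map_smul' := fun _ _ => rfl }
  let T := LinearMap.id.prodMap ofSym2 (M := Fin n → ℝ)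
  have hsymm : LinearMap.range (symmetrize n) ≤ LinearMap.range T := by
    rintro _ ⟨v, rfl⟩
    exact ⟨(v.1, Sym2.lift ⟨fun i j => v.2 i j + v.2 j i, fun i j => add_comm _ _⟩), rfl⟩
  have hrange : Module.finrank ℝ (LinearMap.range T) ≤ Module.finrank ℝ L := by
    refine (LinearMap.finrank_range_le T).trans ?_
    rw [hrank, Module.finrank_prod, Module.finrank_fintype_fun_eq_card,
      Module.finrank_fintype_fun_eq_card, Sym2.card, Fintype.card_fin, Nat.choose_two_right,
      Nat.add_sub_cancel, mul_comm]
  exact hsymm.trans (Submodule.eq_of_le_of_finrank_le (hL.trans hsymm) hrange).ge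

lemma eq_top_of_range_symmetrize_le {D : Submodule ℝ ((Fin n → ℝ) × Matrix (Fin n) (Fin n) ℝ)}
    (hskew : ∀ B : Matrix (Fin n) (Fin n) ℝ, (0, B - B.transpose) ∈ D)
    (hsymm : LinearMap.range (symmetrize n) ≤ D.map (symmetrize n)) : D = ⊤ := by
  refine eq_top_iff.2 fun ⟨v, A⟩ _ => ?_
  obtain ⟨⟨v', A'⟩, hA', hAA'⟩ := hsymm ⟨(v, A), rfl⟩
  obtain ⟨rfl, hAA'⟩ := Prod.ext_iff.1 hAA'
  have hdiff : A = A' + ((2⁻¹ : ℝ) • (A - A') - ((2⁻¹ : ℝ) • (A - A')).transpose) := by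
    have htr : A'.transpose = A + A.transpose - A' := eq_sub_of_add_eq' hAA'
    rw [Matrix.transpose_smul, Matrix.transpose_sub, htr]
    module
  have := D.add_mem hA' (hskew ((2⁻¹ : ℝ) • (A - A')))
  rwa [Prod.mk_add_mk, add_zero, ← hdiff] at this

end Rank

section LieAlgebra

variable {V W : (Fin n → ℝ) → Fin n → ℝ} {m : Fin n → ℝ}

variable {S : Set ((Fin n → ℝ) → Fin n → ℝ)}

lemma oneJet_mem_of_mem_lieAlgebraGen {D : Submodule ℝ ((Fin n → ℝ) × Matrix (Fin n) (Fin n) ℝ)}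
    (hD : ∀ W, IteratedBracket S W → DifferentiableAt ℝ W m ∧ (W m, jacobian W m) ∈ D)
    (hW : W ∈ lieAlgebraGen S) : DifferentiableAt ℝ W m ∧ (W m, jacobian W m) ∈ D := by
  induction hW using Submodule.span_induction with
  | mem W hW => exact hD W hW
  | zero => simp [jacobian_apply, ← Prod.zero_eq_mk]
  | add V W _ _ hV hW =>
    refine ⟨hV.1.add hW.1, ?_⟩
    simpa [jacobian_apply, fderiv_add hV.1 hW.1] using D.add_mem hV.2 hW.2
  | smul c W _ hW =>
    refine ⟨hW.1.const_smul c, ?_⟩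
    simpa [jacobian_apply, fderiv_const_smul hW.1] using D.smul_mem c hW.2

lemma lieOneJet_le_map_symmetrize
    {D : Submodule ℝ ((Fin n → ℝ) × Matrix (Fin n) (Fin n) ℝ)}
    (hD : ∀ W, IteratedBracket S W → DifferentiableAt ℝ W m ∧ (W m, jacobian W m) ∈ D) :
    lieOneJet S m ≤ D.map (symmetrize n) := by
  refine Submodule.span_le.2 ?_
  rintro _ ⟨W, hW, rfl⟩
  exact ⟨_, (oneJet_mem_of_mem_lieAlgebraGen hD hW).2, rfl⟩

end LieAlgebra

section Directions

variable {V W : (Fin n → ℝ) → Fin n → ℝ} {m : Fin n → ℝ}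

variable {d k : ℕ} {M : Set (Fin n → ℝ)} {hM : IsOpen M} {f₀ : (Fin n → ℝ) → Fin n → ℝ}
  {f : Fin k → (Fin n → ℝ) → Fin n → ℝ} {g : (Fin n → ℝ) → Matrix (Fin n) (Fin d) ℝ}
  {hf₀ : ContDiffOn ℝ 3 f₀ M} {hf : ∀ i, ContDiffOn ℝ ∞ (f i) M}
  {hg : ∀ a b, ContDiffOn ℝ 2 (fun m => g m a b) M}

lemma contDiffAt_of_iteratedBracket {S : Set ((Fin n → ℝ) → Fin n → ℝ)}
    (hS : ∀ V ∈ S, ContDiffAt ℝ ∞ V m) (hW : IteratedBracket S W) : ContDiffAt ℝ ∞ W m := by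
  induction hW with
  | of hV => exact hS _ hV
  | bracket hV _ ih => exact (hS _ hV).lieBracket_vectorField ih (by simp)

lemma lift_mem_directions (hW : IteratedBracket (range f) W) :
    ∀ z ∈ (liftedSystem hM hf₀ hf hg).dom, lift W z ∈ (liftedSystem hM hf₀ hf hg).directions z := by
  induction hW with
  | of hV =>
    obtain ⟨i, rfl⟩ := hV
    exact fun z hz =>
      ControlSystem.ctrl_mem_directions (S := liftedSystem hM hf₀ hf hg) (.inl i) hz
  | @bracket V W hV hW ih =>
    obtain ⟨i, rfl⟩ := hV
    intro z hz
    have hsmooth : ∀ V ∈ range f, ContDiffAt ℝ ∞ V z.1 := by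
      rintro _ ⟨j, rfl⟩
      exact (hf j).contDiffAt (hM.mem_nhds hz.1)
    have hWz : ContDiffAt ℝ 2 W z.1 :=
      (contDiffAt_of_iteratedBracket hsmooth hW).of_le (by norm_cast)
    rw [← lieBracket_lift ((hsmooth _ ⟨i, rfl⟩).of_le (by norm_cast)) hWz]
    exact ControlSystem.lieBracket_mem_directions (S := liftedSystem hM hf₀ hf hg) (.inl i) ih hz
      ((contDiffAt_lift hWz (by norm_num : (1 : WithTop ℕ∞) + 1 ≤ 2)).differentiableAt one_ne_zero)

theorem directions_eq_top (hm : m ∈ M)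
    (hrank : Module.finrank ℝ (lieOneJet (range f) m) = n + n * (n + 1) / 2) :
    (liftedSystem hM hf₀ hf hg).directions (m, 1) = ⊤ := by
  have hdom : (m, 1) ∈ (liftedSystem hM hf₀ hf hg).dom := ⟨hm, isUnit_one⟩
  refine eq_top_of_range_symmetrize_le (fun B => ?_) <|
    (range_symmetrize_le_of_finrank_eq ?_ hrank).trans <|
      lieOneJet_le_map_symmetrize fun W hW => ?_
  · simpa [liftedSystem, rotation] using
      ControlSystem.ctrl_mem_directions (S := liftedSystem hM hf₀ hf hg) (.inr B) hdom
  · exact Submodule.span_le.2 (by rintro _ ⟨W, -, rfl⟩; exact ⟨(W m, jacobian W m), rfl⟩)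
  · have hWm : ContDiffAt ℝ ∞ W m := contDiffAt_of_iteratedBracket
      (by rintro _ ⟨j, rfl⟩; exact (hf j).contDiffAt (hM.mem_nhds hm)) hW
    exact ⟨hWm.differentiableAt (by simp), by simpa [lift] using lift_mem_directions hW _ hdom⟩

end Directions

section Projection

variable {d k : ℕ} {p : (Fin n → ℝ) × Matrix (Fin n) (Fin n) ℝ}

/-- The projection `(m, A) ↦ (m, A Aᵀ)` of a frame to a state of the statistical linearization. -/
def project (p : (Fin n → ℝ) × Matrix (Fin n) (Fin n) ℝ) : (Fin n → ℝ) × Matrix (Fin n) (Fin n) ℝ :=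
  (p.1, p.2 * p.2.transpose)

lemma project_mem_stateSpace {M : Set (Fin n → ℝ)} (hp : p ∈ M ×ˢ {A | IsUnit A}) :
    project p ∈ stateSpace M := by
  refine ⟨hp.1, ?_⟩
  have hpsd := Matrix.posSemidef_self_mul_conjTranspose p.2
  rw [Matrix.conjTranspose_eq_transpose_of_trivial] at hpsd
  exact hpsd.posDef_iff_isUnit.2 (hp.2.mul ((Matrix.isUnit_transpose _).2 hp.2))

lemma hasFDerivAt_project :
    HasFDerivAt project ((ContinuousLinearMap.fst ℝ _ _).prod
      (p.2 • (transposeCLM n ∘L .snd ℝ _ _) +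
        MulOpposite.op p.2.transpose • ContinuousLinearMap.snd ℝ (Fin n → ℝ) _)) p :=
  hasFDerivAt_fst.prodMk <|
    hasFDerivAt_snd.mul' ((transposeCLM n).hasFDerivAt.comp p hasFDerivAt_snd)

lemma fderiv_project_apply (q : (Fin n → ℝ) × Matrix (Fin n) (Fin n) ℝ) :
    fderiv ℝ project p q = (q.1, p.2 * q.2.transpose + q.2 * p.2.transpose) := by
  rw [hasFDerivAt_project.fderiv]
  rfl

lemma fderiv_project_lift (W : (Fin n → ℝ) → Fin n → ℝ) :
    fderiv ℝ project p (lift W p) = controlField W (project p) := by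
  rw [fderiv_project_apply]
  simp only [lift, controlField, project, Matrix.transpose_mul, Matrix.mul_assoc, add_comm]

lemma fderiv_project_rotation (B : Matrix (Fin n) (Fin n) ℝ) :
    fderiv ℝ project p (rotation B p) = 0 := by
  rw [fderiv_project_apply]
  refine Prod.ext rfl ?_
  simp only [rotation, Matrix.transpose_mul, Matrix.transpose_sub, Matrix.transpose_transpose,
    Prod.snd_zero]
  noncomm_ring

lemma fderiv_project_liftedDrift (f₀ : (Fin n → ℝ) → Fin n → ℝ)
    (g : (Fin n → ℝ) → Matrix (Fin n) (Fin d) ℝ) (hp : IsUnit p.2) :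
    fderiv ℝ project p (liftedDrift f₀ g p) = driftField f₀ g (project p) := by
  have hdet := (Matrix.isUnit_iff_isUnit_det _).1 hp
  have hinv : p.2⁻¹.transpose * p.2.transpose = 1 := by
    rw [← Matrix.transpose_mul, Matrix.mul_nonsing_inv _ hdet, Matrix.transpose_one]
  rw [liftedDrift, map_add, fderiv_project_lift, fderiv_project_apply]
  refine Prod.ext (add_zero _) ?_
  simp only [Prod.snd_add, controlField, driftField, project, Matrix.transpose_smul,
    Matrix.transpose_mul, Matrix.transpose_transpose, Matrix.mul_smul, Matrix.smul_mul,
    Matrix.mul_assoc, hinv, Matrix.mul_one, Matrix.mul_nonsing_inv_cancel_left _ _ hdet]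
  module

variable {M : Set (Fin n → ℝ)} {hM : IsOpen M} {f₀ : (Fin n → ℝ) → Fin n → ℝ}
  {f : Fin k → (Fin n → ℝ) → Fin n → ℝ} {g : (Fin n → ℝ) → Matrix (Fin n) (Fin d) ℝ}
  {hf₀ : ContDiffOn ℝ 3 f₀ M} {hf : ∀ i, ContDiffOn ℝ ∞ (f i) M}
  {hg : ∀ a b, ContDiffOn ℝ 2 (fun m => g m a b) M}
  {x y : (Fin n → ℝ) × Matrix (Fin n) (Fin n) ℝ}

lemma exists_arc_statLinearization {ε θ : ℝ} (hε : ε ≠ 0) (j : Fin k ⊕ Matrix (Fin n) (Fin n) ℝ)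
    (h : Arc (liftedSystem hM hf₀ hf hg).dom
      (ε • (liftedSystem hM hf₀ hf hg).drift + θ • (liftedSystem hM hf₀ hf hg).ctrl j) x y) :
    ∃ u, Arc (stateSpace M) (ε • (statLinearization f₀ f g · u)) (project x) (project y) := by
  refine ⟨Sum.elim (fun i => Pi.single i (θ / ε)) 0 j, h.map
    (fun p _ => hasFDerivAt_project.differentiableAt) (fun p hp => project_mem_stateSpace hp)
    fun p hp => ?_⟩
  have hdrift : fderiv ℝ project p ((liftedSystem hM hf₀ hf hg).drift p) =
    driftField f₀ g (project p) := fderiv_project_liftedDrift f₀ g hp.2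
  rw [Pi.add_apply, Pi.smul_apply, Pi.smul_apply, map_add, map_smul, map_smul, hdrift]
  rcases j with i | B
  · have hctrl : fderiv ℝ project p ((liftedSystem hM hf₀ hf hg).ctrl (.inl i) p) =
      controlField (f i) (project p) := fderiv_project_lift (f i)
    simp [statLinearization, hctrl, Pi.single_apply, smul_smul, mul_div_cancel₀ _ hε]
  · have hctrl : fderiv ℝ project p ((liftedSystem hM hf₀ hf hg).ctrl (.inr B) p) = 0 :=
      fderiv_project_rotation B
    simp [statLinearization, hctrl]

end Projection

section FrameRel

variable {ι : Type*} {S : ControlSystem ((Fin n → ℝ) × Matrix (Fin n) (Fin n) ℝ) ι}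
  {x y z : (Fin n → ℝ) × Matrix (Fin n) (Fin n) ℝ}

/-- The frames `x` and `y` are on the same orbit up to a rotation, and so are the frames obtained
from them by any linear change of frame. -/
def FrameRel (S : ControlSystem ((Fin n → ℝ) × Matrix (Fin n) (Fin n) ℝ) ι)
    (x y : (Fin n → ℝ) × Matrix (Fin n) (Fin n) ℝ) : Prop :=
  ∃ R : Matrix.orthogonalGroup (Fin n) ℝ,
    ∀ c, IsUnit c → S.Orbit (x.1, x.2 * c) (y.1, y.2 * (R * c))

lemma isUnit_coe_orthogonalGroup (R : Matrix.orthogonalGroup (Fin n) ℝ) :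
    IsUnit (R : Matrix (Fin n) (Fin n) ℝ) := (Unitary.toUnits R).isUnit

lemma FrameRel.trans (h : FrameRel S x y) (h' : FrameRel S y z) : FrameRel S x z := by
  obtain ⟨R, hR⟩ := h
  obtain ⟨R', hR'⟩ := h'
  refine ⟨R' * R, fun c hc => (hR c hc).trans ?_⟩
  simpa [mul_assoc] using hR' _ ((isUnit_coe_orthogonalGroup R).mul hc)

lemma FrameRel.symm (h : FrameRel S x y) : FrameRel S y x := by
  obtain ⟨R, hR⟩ := h
  refine ⟨R⁻¹, fun c hc => ?_⟩
  have := hR (R⁻¹ * c) ((isUnit_coe_orthogonalGroup R⁻¹).mul hc)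
  rw [← mul_assoc (R : Matrix (Fin n) (Fin n) ℝ), ← Submonoid.coe_mul, mul_inv_cancel,
    Submonoid.coe_one, one_mul] at this
  exact this.symm

lemma FrameRel.of_mul_orthogonal {m : Fin n → ℝ} {A : Matrix (Fin n) (Fin n) ℝ}
    {Q : Matrix.orthogonalGroup (Fin n) ℝ} (h : FrameRel S x (m, A * Q)) : FrameRel S x (m, A) := by
  obtain ⟨R, hR⟩ := h
  exact ⟨Q * R, fun c hc => by simpa [mul_assoc] using hR c hc⟩

lemma exists_orthogonal_mul_eq {A B : Matrix (Fin n) (Fin n) ℝ} (hB : IsUnit B)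
    (h : A * A.transpose = B * B.transpose) :
    ∃ R : Matrix.orthogonalGroup (Fin n) ℝ, B * R = A := by
  have hdet := (Matrix.isUnit_iff_isUnit_det _).1 hB
  refine ⟨⟨B⁻¹ * A, (Matrix.mem_orthogonalGroup_iff _ _).2 ?_⟩,
    Matrix.mul_nonsing_inv_cancel_left _ _ hdet⟩
  calc B⁻¹ * A * (B⁻¹ * A).transpose = B⁻¹ * (A * A.transpose) * B⁻¹.transpose := by
        simp only [Matrix.transpose_mul, Matrix.mul_assoc]
    _ = (B⁻¹ * B) * (B⁻¹ * B).transpose := by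
        rw [h]; simp only [Matrix.transpose_mul, Matrix.mul_assoc]
    _ = 1 := by rw [Matrix.nonsing_inv_mul _ hdet, Matrix.transpose_one, one_mul]

end FrameRel

section LiftedSystem

variable {d k : ℕ} {M : Set (Fin n → ℝ)} {hM : IsOpen M} {f₀ : (Fin n → ℝ) → Fin n → ℝ}
  {f : Fin k → (Fin n → ℝ) → Fin n → ℝ} {g : (Fin n → ℝ) → Matrix (Fin n) (Fin d) ℝ}
  {hf₀ : ContDiffOn ℝ 3 f₀ M} {hf : ∀ i, ContDiffOn ℝ ∞ (f i) M}
  {hg : ∀ a b, ContDiffOn ℝ 2 (fun m => g m a b) M}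
  {x y : (Fin n → ℝ) × Matrix (Fin n) (Fin n) ℝ} {m : Fin n → ℝ}

lemma FrameRel.refl (hx : x ∈ (liftedSystem hM hf₀ hf hg).dom) :
    FrameRel (liftedSystem hM hf₀ hf hg) x x :=
  ⟨1, fun c hc => by simpa using .refl ⟨hx.1, hx.2.mul hc⟩⟩

lemma arc_lift_mul_right {W : (Fin n → ℝ) → Fin n → ℝ} {θ : ℝ} {c : Matrix (Fin n) (Fin n) ℝ}
    (hc : IsUnit c) (h : Arc (M ×ˢ {A | IsUnit A}) (θ • lift W) x y) :
    Arc (M ×ˢ {A | IsUnit A}) (θ • lift W) (x.1, x.2 * c) (y.1, y.2 * c) := by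
  let mulRight : (Fin n → ℝ) × Matrix (Fin n) (Fin n) ℝ →L[ℝ]
      (Fin n → ℝ) × Matrix (Fin n) (Fin n) ℝ :=
    (ContinuousLinearMap.id ℝ _).prodMap ((ContinuousLinearMap.mul ℝ _).flip c)
  refine h.map (T := mulRight) (fun p _ => mulRight.differentiableAt)
    (fun p hp => ⟨hp.1, hp.2.mul hc⟩) fun p _ => ?_
  rw [mulRight.fderiv]
  exact Prod.ext rfl (by simp [mulRight, lift, mul_assoc])

lemma project_eq_of_arc_rotation {U : Set ((Fin n → ℝ) × Matrix (Fin n) (Fin n) ℝ)} {θ : ℝ}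
    {B : Matrix (Fin n) (Fin n) ℝ} (h : Arc U (θ • rotation B) x y) : project x = project y :=
  h.eq_of_fderiv_apply_eq_zero (fun p _ => hasFDerivAt_project.differentiableAt) fun p _ => by
    rw [Pi.smul_apply, map_smul, fderiv_project_rotation, smul_zero]

lemma FrameRel.of_project_eq (hx : x ∈ (liftedSystem hM hf₀ hf hg).dom)
    (hy : y ∈ (liftedSystem hM hf₀ hf hg).dom) (h : project x = project y) :
    FrameRel (liftedSystem hM hf₀ hf hg) x y := by
  obtain ⟨m, A⟩ := x
  obtain ⟨m', B⟩ := y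
  obtain ⟨rfl, hAB⟩ : m = m' ∧ A * A.transpose = B * B.transpose := Prod.ext_iff.1 h
  obtain ⟨R, rfl⟩ := exists_orthogonal_mul_eq hy.2 hAB
  exact (FrameRel.refl hx).of_mul_orthogonal

lemma FrameRel.of_orbit (h : (liftedSystem hM hf₀ hf hg).Orbit x y) :
    FrameRel (liftedSystem hM hf₀ hf hg) x y := by
  refine ControlSystem.Orbit.induction (P := FrameRel (liftedSystem hM hf₀ hf hg))
    (fun _ => .refl) (fun x y z j θ hxy hyz => .trans ?_ hyz) h
  rcases j with i | B
  · exact ⟨1, fun c hc => .single (.inl i) θ (by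
      rw [Submonoid.coe_one, one_mul]; exact arc_lift_mul_right hc hxy)⟩
  · exact .of_project_eq hxy.left_mem hxy.right_mem (project_eq_of_arc_rotation hxy)

lemma FrameRel.exists_mul_of_eventually_orbit
    (hloc : ∀ᶠ y in 𝓝 (m, (1 : Matrix (Fin n) (Fin n) ℝ)),
      (liftedSystem hM hf₀ hf hg).Orbit (m, 1) y) :
    ∃ δ > 0, ∀ C u, FrameRel (liftedSystem hM hf₀ hf hg) (m, 1) (m, C) → ‖u - 1‖ < δ →
      FrameRel (liftedSystem hM hf₀ hf hg) (m, 1) (m, C * u) := by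
  obtain ⟨δ, hδ, hball⟩ := Metric.eventually_nhds_iff.1
    (((Continuous.prodMk_right m).tendsto (1 : Matrix (Fin n) (Fin n) ℝ)).eventually hloc)
  refine ⟨δ, hδ, fun C u ⟨R, hR⟩ hu => ?_⟩
  have hinv : ((R⁻¹ : Matrix.orthogonalGroup (Fin n) ℝ) : Matrix (Fin n) (Fin n) ℝ) * R = 1 := by
    rw [← Submonoid.coe_mul, inv_mul_cancel, Submonoid.coe_one]
  have hinv' : (R : Matrix (Fin n) (Fin n) ℝ) * (R⁻¹ : Matrix.orthogonalGroup (Fin n) ℝ) = 1 := by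
    rw [← Submonoid.coe_mul, mul_inv_cancel, Submonoid.coe_one]
  set Q : Matrix.orthogonalGroup (Fin n) ℝ := R⁻¹
  have hdist : dist ((Q : Matrix (Fin n) (Fin n) ℝ) * u * R) 1 < δ := by
    rw [dist_eq_norm, show (Q : Matrix (Fin n) (Fin n) ℝ) * u * R - 1 = Q * (u - 1) * R by
      rw [mul_sub, sub_mul, mul_one, hinv]]
    simpa using hu
  have hconj := hball hdist
  have := hconj.trans (by simpa using hR _ hconj.right_mem.2)
  rw [← mul_assoc (R : Matrix (Fin n) (Fin n) ℝ), ← mul_assoc (R : Matrix (Fin n) (Fin n) ℝ),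
    hinv', one_mul, ← mul_assoc] at this
  exact (FrameRel.of_orbit this).of_mul_orthogonal

lemma frameRel_of_posDef (hm : m ∈ M)
    (hloc : ∀ᶠ y in 𝓝 (m, (1 : Matrix (Fin n) (Fin n) ℝ)),
      (liftedSystem hM hf₀ hf hg).Orbit (m, 1) y)
    {C : Matrix (Fin n) (Fin n) ℝ} (hC : C.PosDef) :
    FrameRel (liftedSystem hM hf₀ hf hg) (m, 1) (m, C) := by
  obtain ⟨δ, hδ, hmul⟩ := FrameRel.exists_mul_of_eventually_orbit hloc
  have hconvex : Convex ℝ {C : Matrix (Fin n) (Fin n) ℝ | C.PosDef} :=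
    convex_iff_forall_pos.2 fun A hA B hB a b ha hb _ => (hA.smul ha).add (hB.smul hb)
  refine hconvex.isPreconnected.induction₂' (fun C C' => FrameRel (liftedSystem hM hf₀ hf hg)
      (m, 1) (m, C) → FrameRel (liftedSystem hM hf₀ hf hg) (m, 1) (m, C'))
    (fun C hC => ?_) (fun _ _ _ _ _ _ h h' => h' ∘ h) Matrix.PosDef.one hC (.refl ⟨hm, isUnit_one⟩)
  have hstep : ∀ A B : Matrix (Fin n) (Fin n) ℝ, A.PosDef → ‖A⁻¹ * B - 1‖ < δ →
      FrameRel (liftedSystem hM hf₀ hf hg) (m, 1) (m, A) →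
        FrameRel (liftedSystem hM hf₀ hf hg) (m, 1) (m, B) := fun A B hA hAB h => by
    simpa [Matrix.mul_nonsing_inv_cancel_left _ _ ((Matrix.isUnit_iff_isUnit_det _).1 hA.isUnit)]
      using hmul A _ h hAB
  have hone : C⁻¹ * C = 1 :=
    Matrix.nonsing_inv_mul _ ((Matrix.isUnit_iff_isUnit_det _).1 hC.isUnit)
  have hinv : ContinuousAt (fun C' : Matrix (Fin n) (Fin n) ℝ => C'⁻¹) C := by
    obtain ⟨a, rfl⟩ := hC.isUnit
    simpa only [Matrix.nonsing_inv_eq_ringInverse] using NormedRing.inverse_continuousAt a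
  have hleft : ∀ᶠ C' in 𝓝 C, ‖C⁻¹ * C' - 1‖ < δ :=
    ((continuous_const.mul continuous_id).sub continuous_const).norm.continuousAt.eventually_lt
      continuousAt_const (by simpa [hone] using hδ)
  have hright : ∀ᶠ C' in 𝓝 C, ‖C'⁻¹ * C - 1‖ < δ :=
    ((hinv.mul continuousAt_const).sub continuousAt_const).norm.eventually_lt
      continuousAt_const (by simpa [hone] using hδ)
  filter_upwards [nhdsWithin_le_nhds hleft, nhdsWithin_le_nhds hright, self_mem_nhdsWithin]
    with C' hl hr hC'
  exact ⟨hstep C C' hC hl, hstep C' C hC' hr⟩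

open scoped MatrixOrder in
lemma exists_posDef_mul_transpose_eq {P : Matrix (Fin n) (Fin n) ℝ} (hP : P.PosDef) :
    ∃ C : Matrix (Fin n) (Fin n) ℝ, C.PosDef ∧ C * C.transpose = P := by
  have hsqrt : CFC.sqrt P * CFC.sqrt P = P := CFC.sqrt_mul_sqrt_self P hP.posSemidef.nonneg
  have hpsd : (CFC.sqrt P).PosSemidef := Matrix.nonneg_iff_posSemidef.1 (CFC.sqrt_nonneg P)
  refine ⟨CFC.sqrt P, hpsd.posDef_iff_isUnit.2
    (isUnit_of_mul_isUnit_left (y := CFC.sqrt P) (hsqrt.symm ▸ hP.isUnit)), ?_⟩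
  rwa [← Matrix.conjTranspose_eq_transpose_of_trivial, hpsd.isHermitian.eq]

lemma frameRel_of_isPreconnected (hM_conn : IsPreconnected M)
    (hloc : ∀ m ∈ M, ∀ᶠ y in 𝓝 (m, (1 : Matrix (Fin n) (Fin n) ℝ)),
      (liftedSystem hM hf₀ hf hg).Orbit (m, 1) y)
    {m m' : Fin n → ℝ} (hm : m ∈ M) (hm' : m' ∈ M) :
    FrameRel (liftedSystem hM hf₀ hf hg) (m, 1) (m', 1) := by
  refine hM_conn.induction₂
    (fun m m' => FrameRel (liftedSystem hM hf₀ hf hg) (m, 1) (m', 1))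
    (fun m hm => nhdsWithin_le_nhds ?_) (fun _ _ _ _ _ _ => .trans) (fun _ _ _ _ => .symm) hm hm'
  exact (((Continuous.prodMk_left 1).tendsto m).eventually (hloc m hm)).mono fun _ => .of_orbit

lemma exists_orbit_of_posDef (hM_conn : IsPreconnected M)
    (hloc : ∀ m ∈ M, ∀ᶠ y in 𝓝 (m, (1 : Matrix (Fin n) (Fin n) ℝ)),
      (liftedSystem hM hf₀ hf hg).Orbit (m, 1) y)
    {X : (Fin n → ℝ) × Matrix (Fin n) (Fin n) ℝ} (hm : m ∈ M) (hX : X ∈ stateSpace M) :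
    ∃ y, project y = X ∧ (liftedSystem hM hf₀ hf hg).Orbit (m, 1) y := by
  obtain ⟨m', P⟩ := X
  obtain ⟨hm', hP⟩ : m' ∈ M ∧ P.PosDef := hX
  obtain ⟨C, hC, rfl⟩ := exists_posDef_mul_transpose_eq hP
  obtain ⟨R, hR⟩ := (frameRel_of_isPreconnected hM_conn hloc hm hm').trans
    (frameRel_of_posDef hm' (hloc m' hm') hC)
  refine ⟨(m', C * R), Prod.ext rfl ?_, by simpa using hR 1 isUnit_one⟩
  have hRR : (R : Matrix (Fin n) (Fin n) ℝ) * (R : Matrix (Fin n) (Fin n) ℝ).transpose = 1 :=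
    (Matrix.mem_orthogonalGroup_iff _ _).1 R.2
  calc C * R * (C * R).transpose
      = C * (R * (R : Matrix (Fin n) (Fin n) ℝ).transpose) * C.transpose := by
        simp only [Matrix.transpose_mul, Matrix.mul_assoc]
    _ = C * C.transpose := by rw [hRR, mul_one]

end LiftedSystem

section Reachable

/-- The concatenation of two curves, the second of which starts at time `T`. -/
noncomputable def joinAt {E : Type*} (T : ℝ) (a b : ℝ → E) (t : ℝ) : E :=
  if t ≤ T then a t else b (t - T)

section Append

variable {E : Type*} {T t : ℝ} {a b : ℝ → E}

lemma joinAt_of_le (ht : t ≤ T) : joinAt T a b t = a t := if_pos ht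

lemma joinAt_of_lt (ht : T < t) : joinAt T a b t = b (t - T) := if_neg ht.not_ge

lemma joinAt_of_ge (hab : a T = b 0) (ht : T ≤ t) : joinAt T a b t = b (t - T) := by
  rcases ht.eq_or_lt with rfl | ht
  · rw [joinAt_of_le le_rfl, sub_self, hab]
  · exact joinAt_of_lt ht

lemma joinAt_eventuallyEq_left (ht : t < T) : joinAt T a b =ᶠ[𝓝 t] a :=
  (eventually_le_nhds ht).mono fun _ => joinAt_of_le

lemma joinAt_eventuallyEq_right (ht : T < t) : joinAt T a b =ᶠ[𝓝 t] fun r => b (r - T) :=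
  (eventually_gt_nhds ht).mono fun _ => joinAt_of_lt

end Append

variable {k : ℕ} {Ω : Set ((Fin n → ℝ) × Matrix (Fin n) (Fin n) ℝ)}
  {F : (Fin n → ℝ) × Matrix (Fin n) (Fin n) ℝ → (Fin k → ℝ) →
    (Fin n → ℝ) × Matrix (Fin n) (Fin n) ℝ}
  {x y z : (Fin n → ℝ) × Matrix (Fin n) (Fin n) ℝ} {T T₁ T₂ : ℝ}

lemma IsTrajectory.append {u₁ u₂ : ℝ → Fin k → ℝ}
    {X₁ X₂ : ℝ → (Fin n → ℝ) × Matrix (Fin n) (Fin n) ℝ} (h₁ : IsTrajectory Ω F T₁ u₁ X₁)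
    (h₂ : IsTrajectory Ω F T₂ u₂ X₂) (h : X₁ T₁ = X₂ 0) :
    IsTrajectory Ω F (T₁ + T₂) (joinAt T₁ u₁ u₂) (joinAt T₁ X₁ X₂) := by
  have hshift : MapsTo (fun t => t - T₁) (Icc T₁ (T₁ + T₂)) (Icc 0 T₂) := fun t ht =>
    ⟨sub_nonneg.2 ht.1, sub_le_iff_le_add'.2 ht.2⟩
  refine ⟨?_, fun t ht => ?_, ?_⟩
  · refine (ContinuousOn.union_of_isClosed
      (h₁.continuousOn.congr fun t ht => joinAt_of_le ht.2)
      ((h₂.continuousOn.comp (by fun_prop) hshift).congr fun t ht => joinAt_of_ge h ht.1)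
      isClosed_Icc isClosed_Icc).mono fun t ht => ?_
    exact (le_total t T₁).imp (fun h => ⟨ht.1, h⟩) fun h => ⟨h, ht.2⟩
  · rcases le_total t T₁ with hle | hge
    · rw [joinAt_of_le hle]
      exact h₁.mem t ⟨ht.1, hle⟩
    · rw [joinAt_of_ge h hge]
      exact h₂.mem _ (hshift ⟨hge, ht.2⟩)
  obtain ⟨s₁, hs₁⟩ := h₁.piecewise
  obtain ⟨s₂, hs₂⟩ := h₂.piecewise
  refine ⟨insert T₁ (s₁ ∪ s₂.image (· + T₁)), fun t ht hts => ?_⟩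
  simp only [Finset.mem_insert, Finset.mem_union, Finset.mem_image, not_or, not_exists,
    not_and] at hts
  obtain ⟨hne, ht₁, ht₂⟩ := hts
  rcases lt_or_gt_of_ne hne with hlt | hgt
  · obtain ⟨hu, hX⟩ := hs₁ t ⟨ht.1, hlt⟩ ht₁
    have hu_eq : joinAt T₁ u₁ u₂ =ᶠ[𝓝 t] u₁ := joinAt_eventuallyEq_left hlt
    rw [joinAt_of_le hlt.le, joinAt_of_le hlt.le]
    exact ⟨hu_eq.trans hu, hX.congr_of_eventuallyEq (joinAt_eventuallyEq_left hlt)⟩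
  · obtain ⟨hu, hX⟩ := hs₂ (t - T₁) ⟨sub_pos.2 hgt, sub_lt_iff_lt_add'.2 ht.2⟩
      fun hmem => ht₂ _ hmem (sub_add_cancel t T₁)
    have hu_eq : joinAt T₁ u₁ u₂ =ᶠ[𝓝 t] fun r => u₂ (r - T₁) := joinAt_eventuallyEq_right hgt
    have hsub : Tendsto (fun r => r - T₁) (𝓝 t) (𝓝 (t - T₁)) :=
      (continuous_id.sub continuous_const).tendsto t
    rw [joinAt_of_lt hgt, joinAt_of_lt hgt]
    exact ⟨hu_eq.trans (hsub.eventually hu),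
      (hX.comp_sub_const t T₁).congr_of_eventuallyEq (joinAt_eventuallyEq_right hgt)⟩

lemma mem_reachableSet_zero (hx : x ∈ Ω) : x ∈ reachableSet Ω F x 0 :=
  ⟨fun _ => 0, fun _ => x, ⟨continuousOn_const, fun _ _ => hx, ∅, fun _ ht => by simp at ht⟩,
    rfl, rfl⟩

lemma mem_reachableSet_add (hT₁ : 0 ≤ T₁) (hT₂ : 0 ≤ T₂) (hxy : y ∈ reachableSet Ω F x T₁)
    (hyz : z ∈ reachableSet Ω F y T₂) : z ∈ reachableSet Ω F x (T₁ + T₂) := by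
  obtain ⟨u₁, X₁, h₁, rfl, rfl⟩ := hxy
  obtain ⟨u₂, X₂, h₂, h, rfl⟩ := hyz
  refine ⟨_, _, h₁.append h₂ h.symm, joinAt_of_le hT₁, ?_⟩
  rw [joinAt_of_ge h.symm (le_add_of_nonneg_right hT₂), add_sub_cancel_left]

lemma reachableSet_subset (hT : 0 ≤ T) : reachableSet Ω F x T ⊆ Ω := by
  rintro _ ⟨u, X, h, -, rfl⟩
  exact h.mem T ⟨hT, le_rfl⟩

lemma mem_reachableSet_of_arc {u : Fin k → ℝ} (hT : 0 < T)
    (h : Arc Ω (T • fun p => F p u) x y) : y ∈ reachableSet Ω F x T := by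
  obtain ⟨γ, rfl, rfl, hmaps, hγ⟩ := h
  have hdiv : MapsTo (fun t : ℝ => t / T) (Icc 0 T) (Icc 0 1) := fun t ht =>
    ⟨div_nonneg ht.1 hT.le, (div_le_one hT).2 ht.2⟩
  refine ⟨fun _ => u, fun t => γ (t / T), ⟨hγ.continuousOn.comp (by fun_prop) hdiv,
    fun t ht => hmaps (hdiv ht), ∅, fun t ht _ => ⟨.of_forall fun _ => rfl, ?_⟩⟩, by simp,
    by simp [hT.ne']⟩
  have htT : t / T ∈ Ioo (0 : ℝ) 1 := ⟨div_pos ht.1 hT, (div_lt_one hT).2 ht.2⟩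
  have hder := ((hγ _ (Ioo_subset_Icc_self htT)).hasDerivAt (Icc_mem_nhds htT.1 htT.2)).scomp t
    ((hasDerivAt_id t).div_const T)
  simp only [Pi.smul_apply, smul_smul, one_div, inv_mul_cancel₀ hT.ne', one_smul] at hder
  exact hder

lemma controllableFreeAndFixedTime_of_forall_lt
    (h : ∀ x ∈ Ω, ∀ y ∈ Ω, ∃ T₀ > 0, ∀ T, 0 < T → T < T₀ → y ∈ reachableSet Ω F x T) :
    ControllableFreeAndFixedTime Ω F := by
  refine fun x hx => ⟨subset_antisymm (iUnion₂_subset fun T hT => reachableSet_subset hT)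
    fun y hy => ?_, ?_⟩
  · obtain ⟨T₀, hT₀, hreach⟩ := h x hx y hy
    exact mem_iUnion₂.2 ⟨T₀ / 2, (half_pos hT₀).le, hreach _ (half_pos hT₀) (half_lt_self hT₀)⟩
  obtain ⟨T₀, hT₀, hloop⟩ := h x hx x hx
  refine ⟨T₀, hT₀, fun T hT hTT₀ => subset_antisymm (reachableSet_subset hT.le) fun y hy => ?_⟩
  obtain ⟨T₁, hT₁, hreach⟩ := h x hx y hy
  obtain ⟨τ, hτ, hτT⟩ := exists_between (lt_min hT hT₁)
  obtain ⟨hτT, hτT₁⟩ := lt_min_iff.1 hτT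
  have := mem_reachableSet_add (sub_pos.2 hτT).le hτ.le
    (hloop (T - τ) (sub_pos.2 hτT) (by linarith)) (hreach τ hτ hτT₁)
  rwa [sub_add_cancel] at this

end Reachable

section Controllability

variable {d k : ℕ} {M : Set (Fin n → ℝ)} {hM : IsOpen M} {f₀ : (Fin n → ℝ) → Fin n → ℝ}
  {f : Fin k → (Fin n → ℝ) → Fin n → ℝ} {g : (Fin n → ℝ) → Matrix (Fin n) (Fin d) ℝ}
  {hf₀ : ContDiffOn ℝ 3 f₀ M} {hf : ∀ i, ContDiffOn ℝ ∞ (f i) M}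
  {hg : ∀ a b, ContDiffOn ℝ 2 (fun m => g m a b) M}
  {x y : (Fin n → ℝ) × Matrix (Fin n) (Fin n) ℝ}

lemma project_mem_reachableSet_of_chain {ε : ℝ} (hε : 0 < ε) {ℓ : ℕ}
    (h : (liftedSystem hM hf₀ hf hg).Chain ε ℓ x y) :
    project y ∈ reachableSet (stateSpace M) (statLinearization f₀ f g) (project x) (ℓ * ε) := by
  induction h with
  | nil hx => simpa using mem_reachableSet_zero (project_mem_stateSpace hx)
  | @cons ℓ x y z j θ harc _ ih =>
    obtain ⟨u, hu⟩ := exists_arc_statLinearization hε.ne' j harc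
    rw [show ((ℓ + 1 : ℕ) : ℝ) * ε = ε + ℓ * ε by push_cast; ring]
    exact mem_reachableSet_add hε.le (by positivity) (mem_reachableSet_of_arc hε hu) ih

lemma exists_forall_lt_mem_reachableSet (hM : IsOpen M) (hM_conn : IsPreconnected M)
    (hf₀ : ContDiffOn ℝ 3 f₀ M) (hf : ∀ i, ContDiffOn ℝ ∞ (f i) M)
    (hg : ∀ a b, ContDiffOn ℝ 2 (fun m => g m a b) M)
    (hrank : ∀ m ∈ M, Module.finrank ℝ (lieOneJet (Set.range f) m) = n + n * (n + 1) / 2)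
    (hx : x ∈ stateSpace M) (hy : y ∈ stateSpace M) :
    ∃ T₀ > 0, ∀ T, 0 < T → T < T₀ →
      y ∈ reachableSet (stateSpace M) (statLinearization f₀ f g) x T := by
  have hdir : ∀ m ∈ M, (liftedSystem hM hf₀ hf hg).directions (m, 1) = ⊤ := fun m hm =>
    directions_eq_top hm (hrank m hm)
  have hloc : ∀ m ∈ M, ∀ᶠ y in 𝓝 (m, (1 : Matrix (Fin n) (Fin n) ℝ)),
      (liftedSystem hM hf₀ hf hg).Orbit (m, 1) y := fun m hm =>
    ControlSystem.eventually_orbit ⟨hm, isUnit_one⟩ (hdir m hm)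
  obtain ⟨A, rfl, hA⟩ := exists_orbit_of_posDef hM_conn hloc hx.1 hx
  obtain ⟨B, rfl, hB⟩ := exists_orbit_of_posDef hM_conn hloc hx.1 hy
  obtain ⟨ℓ, hℓ, hchain⟩ := ControlSystem.exists_chain_of_orbit hA.symm hB (hdir _ hx.1)
  have hchain₀ : ∀ᶠ ε in 𝓝 (0 : ℝ), (liftedSystem hM hf₀ hf hg).Chain ε ℓ A B :=
    ((Continuous.prodMk_left B).tendsto 0).eventually hchain
  obtain ⟨δ, hδ, hball⟩ := Metric.eventually_nhds_iff.1 hchain₀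
  have hℓ' : (0 : ℝ) < ℓ := Nat.cast_pos.2 hℓ
  refine ⟨ℓ * δ, by positivity, fun T hT hTδ => ?_⟩
  have hdist : dist (T / ℓ) 0 < δ := by
    rwa [dist_zero_right, Real.norm_of_nonneg (by positivity), div_lt_iff₀' hℓ']
  have := project_mem_reachableSet_of_chain (div_pos hT hℓ') (hball hdist)
  rwa [mul_div_cancel₀ _ hℓ'.ne'] at this

end Controllability

end StatLin

theorem mainTheorem6_general {n d k : ℕ} {M : Set (Fin n → ℝ)} (hM_open : IsOpen M)
    (hM_conn : IsPreconnected M) {f₀ : (Fin n → ℝ) → (Fin n → ℝ)}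
    {f : Fin k → (Fin n → ℝ) → (Fin n → ℝ)} {g : (Fin n → ℝ) → Matrix (Fin n) (Fin d) ℝ}
    (hf₀ : ContDiffOn ℝ 3 f₀ M) (hf : ∀ i, ContDiffOn ℝ ∞ (f i) M)
    (hg : ∀ a b, ContDiffOn ℝ 2 (fun m => g m a b) M)
    (hrank : ∀ m ∈ M,
      Module.finrank ℝ (StatLin.lieOneJet (Set.range f) m) = n + n * (n + 1) / 2) :
    StatLin.ControllableFreeAndFixedTime (StatLin.stateSpace M)
      (StatLin.statLinearization f₀ f g) :=
  StatLin.controllableFreeAndFixedTime_of_forall_lt fun _ hx _ hy =>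
    StatLin.exists_forall_lt_mem_reachableSet hM_open hM_conn hf₀ hf hg hrank hx hy

theorem mainTheorem6 {n d k : ℕ} (M : Set (Fin n → ℝ)) (hM_open : IsOpen M)
    (hM_conn : IsConnected M)
    (f₀ : (Fin n → ℝ) → (Fin n → ℝ)) (f : Fin k → (Fin n → ℝ) → (Fin n → ℝ))
    (g : (Fin n → ℝ) → Matrix (Fin n) (Fin d) ℝ)
    (hf₀ : ContDiffOn ℝ ∞ f₀ M) (hf : ∀ i, ContDiffOn ℝ ∞ (f i) M)
    (hg : ∀ a b, ContDiffOn ℝ ∞ (fun m => g m a b) M)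
    (hrank : ∀ m ∈ M,
      Module.finrank ℝ (StatLin.lieOneJet (Set.range f) m) = n + n * (n + 1) / 2) :
    StatLin.ControllableFreeAndFixedTime (StatLin.stateSpace M)
      (StatLin.statLinearization f₀ f g) :=
  mainTheorem6_general hM_open hM_conn.isPreconnected (hf₀.of_le ENat.LEInfty.out) hf
    (fun a b => (hg a b).of_le ENat.LEInfty.out) hrank
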